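/- **The free adjunction generated by $(0,1)$.** The objects of $\mathcal B$ are the words $(GF)^n\emptyset$ and those of $\mathcal A$ the words $F(GF)^n\emptyset$, $n\ge 0$. The terms of $\mathcal A$ and $\mathcal B$ are defined inductively: identities $\mathbf 1_a:a\to a$ (in $\mathcal A$) and $\mathbf 1_b:b\to b$ (in $\mathcal B$); composites $f_2\circ f_1$ in $\mathcal A$ and $g_2\circ g_1$ in $\mathcal B$; $Fg:Fb_1\to Fb_2$ in $\mathcal A$ for $g:b_1\to b_2$ in $\mathcal B$; $Gf:Ga_1\to Ga_2$ in $\mathcal B$ for $f:a_1\to a_2$ in $\mathcal A$; $\varphi^a f:FGa_1\to a_2$ in $\mathcal A$ for $f:a_1\to a_2$ in $\mathcal A$; and $\gamma^c g:b_1\to GFb_2$ in $\mathcal B$ for $g:b_1\to b_2$ in $\mathcal B$. Equality of terms is the congruence generated by the category equations, functoriality of $F$ and $G$, and $$f_2\circ\varphi^a f_1=\varphi^a(f_2\circ f_1),\quad \varphi^a f_2\circ FGf_1=\varphi^a(f_2\circ f_1),\quad \varphi^a f\circ F\gamma^c g=f\circ Fg,$$ $$\gamma^c g_2\circ g_1=\gamma^c(g_2\circ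 g_1),\quad GFg_2\circ\gamma^c g_1=\gamma^c(g_2\circ g_1),\quad G\varphi^a f\circ\gamma^c g=Gf\circ g.$$ The arrows of the categories $\mathcal A$ and $\mathcal B$ are the equivalence classes of terms. A term is in *normal form* if it contains no $\circ$ and its only identity symbol is $\mathbf 1_\emptyset$. **Friezes.** A frieze is a set of segments $[a,b]$ ($a<b$) in $\mathbb Z\setminus\{0\}$ such that any two distinct segments are disjoint or one strictly encloses the other at both ends, every element of $\mathbb Z\setminus\{0\}$ is an end point of a segment, every segment with $a>0$ (a cup) is of the form $[2k+2,2k+3]$, and every segment with $b<0$ (a cap) is of the form $[-(2k+2),-(2k+1)]$, $k\in\mathbb N$. It is of type $(n,m)$ if it contains $[-(m+k),n+k]$ for all $k\ge1$. The unit frieze is $\{[-(k+1),k+1]\mid k\in\mathbb N\}$. The composite $D_2\circ D_1$ is obtained by placing $D_2$ below $D_1$, identifying the point $-j$ of $D_1$ with the point $j$ of $D_2$ for all $j\geq 1$, and joining two of the remaining points whenever a path of segments connects them. $\mathcal D_{\mathcal A}$ (respectively $\mathcal D_{\mathcal B}$) is the category whose objects are the odd (respectively even) natural numbers and whose arrows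 $n\to m$ are the friezes of type $(n,m)$, indexed by $(n,m)$. **The functors.** $E_{\mathcal A}(F(GF)^n\emptyset)=2n+1$ and $E_{\mathcal B}((GF)^n\emptyset)=2n$. On terms, $E_{\mathcal A}$ and $E_{\mathcal B}$ send identities to unit friezes and composites to composites; $Fg$ and $Gf$ have the same frieze as $g$ and $f$, with the index $(n,m)$ replaced by $(n+1,m+1)$. If the frieze of $f$ is indexed by $(n,m)$, that of $\varphi^a f$ is indexed by $(n+2,m)$ and is obtained by replacing the segments $[-(m+k),n+k]$, $k\ge1$, by the cup $[n+1,n+2]$ and the segments $[-(m+k),n+k+2]$, $k\ge1$. If the frieze of $g$ is indexed by $(n,m)$, that of $\gamma^c g$ is indexed by $(n,m+2)$ and is obtained by replacing the segments $[-(m+k),n+k]$, $k\ge1$, by the cap $[-(m+2),-(m+1)]$ and the segments $[-(m+k+2),n+k]$, $k\ge1$. Equal terms have equal friezes, so this defines functors $E_{\mathcal A}:\mathcal A\to\mathcal D_{\mathcal A}$ and $E_{\mathcal B}:\mathcal B\to\mathcal D_{\mathcal B}$. **Theorem.** The functors $E_{\mathcal A}$ and $E_{\mathcal B}$ are isomorphisms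 of categories. Moreover, writing $E$ for $E_{\mathcal A}$ on terms of $\mathcal A$ and for $E_{\mathcal B}$ on terms of $\mathcal B$: 1. (Surjectivity) for objects $c_1,c_2$ of $\mathcal A$ (respectively $\mathcal B$), every frieze of type $(E(c_1),E(c_2))$ is $E(h)$ for some term $h:c_1\to c_2$; 2. (Auxiliary) if $h_1,h_2:c_1\to c_2$ are terms in normal form, both of $\mathcal A$ or both of $\mathcal B$, with $E(h_1)=E(h_2)$, then $h_1$ and $h_2$ are the same term; 3. (Injectivity) if $h_1,h_2:c_1\to c_2$ are terms, both of $\mathcal A$ or both of $\mathcal B$, with $E(h_1)=E(h_2)$, then $h_1=h_2$ in $\mathcal A$, respectively $\mathcal B$; 4. (Unique normal form) every term of $\mathcal A$ and every term of $\mathcal B$ is equal, in $\mathcal A$ respectively $\mathcal B$, to exactly one term in normal form. -/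

import Mathlib

open CategoryTheory

namespace FreeAdjunction

/-! ## Friezes -/

/-- The segment of `ℤ ∖ {0}` with end points `s.1` and `s.2`, as a set of integers.  Segments
are represented by their pairs of end points. -/
def segSet (s : ℤ × ℤ) : Set ℤ := {z | z ≠ 0 ∧ s.1 ≤ z ∧ z ≤ s.2}

/-- The segment `s` encloses the segment `t`. -/
def Encloses (s t : ℤ × ℤ) : Prop := s.1 < t.1 ∧ t.2 < s.2

/-- A frieze: a set of nonoverlapping segments exhausting `ℤ ∖ {0}`, whose cups are of the form
`[2k+2, 2k+3]` and whose caps are of the form `[-(2k+2), -(2k+1)]`. -/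
structure IsFrieze (D : Set (ℤ × ℤ)) : Prop where
  isSeg : ∀ s ∈ D, s.1 ≠ 0 ∧ s.2 ≠ 0 ∧ s.1 < s.2
  nonoverlapping : ∀ s ∈ D, ∀ t ∈ D, s ≠ t →
    Disjoint (segSet s) (segSet t) ∨ Encloses s t ∨ Encloses t s
  exhausts : ∀ a : ℤ, a ≠ 0 → ∃ s ∈ D, s.1 = a ∨ s.2 = a
  cup : ∀ s ∈ D, 0 < s.1 → ∃ k : ℕ, s = (2 * (k : ℤ) + 2, 2 * (k : ℤ) + 3)
  cap : ∀ s ∈ D, s.2 < 0 → ∃ k : ℕ, s = (-(2 * (k : ℤ) + 2), -(2 * (k : ℤ) + 1))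

/-- `D` is of type `(n, m)`: the transversal segment `[-(m+k), n+k]` is in `D` for all `k ≥ 1`. -/
def HasType (D : Set (ℤ × ℤ)) (n m : ℕ) : Prop :=
  ∀ k : ℕ, 0 < k → (-((m : ℤ) + k), (n : ℤ) + k) ∈ D

/-- The unit frieze. -/
def unitFrieze : Set (ℤ × ℤ) := {s | ∃ k : ℕ, s = (-((k : ℤ) + 1), (k : ℤ) + 1)}

/-- The points of two stacked diagrams: those on the top line, those on the line in the middle
where the diagrams are glued together, and those on the bottom line. -/
inductive Pt : Type
  | top (x : ℕ) : Pt
  | mid (x : ℕ) : Pt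
  | bot (x : ℕ) : Pt

/-- The end points of the upper diagram: its bottom line is the middle line. -/
def upper (a : ℤ) : Pt := if 0 < a then .top a.natAbs else .mid a.natAbs

/-- The end points of the lower diagram: its top line is the middle line. -/
def lower (a : ℤ) : Pt := if 0 < a then .mid a.natAbs else .bot a.natAbs

/-- The end points of the composed diagram. -/
def outer (a : ℤ) : Pt := if 0 < a then .top a.natAbs else .bot a.natAbs

/-- Two points of the stacked diagrams are the end points of one segment of `D₁` (the upper
diagram) or of `D₂` (the lower diagram). -/
inductive Link (D₂ D₁ : Set (ℤ × ℤ)) : Pt → Pt → Prop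
  | up (s : ℤ × ℤ) (hs : s ∈ D₁) : Link D₂ D₁ (upper s.1) (upper s.2)
  | low (s : ℤ × ℤ) (hs : s ∈ D₂) : Link D₂ D₁ (lower s.1) (lower s.2)

/-- The composition `D₂ ∘ D₁`: the diagram of `D₂` is put below that of `D₁`, and two points on
the outer lines are joined when a path of segments of `D₁` and `D₂` leads from one to the
other. -/
def glue (D₂ D₁ : Set (ℤ × ℤ)) : Set (ℤ × ℤ) :=
  {s | s.1 ≠ 0 ∧ s.2 ≠ 0 ∧ s.1 < s.2 ∧ Relation.EqvGen (Link D₂ D₁) (outer s.1) (outer s.2)}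

/-- Replacing, in a frieze of type `(n, m)`, the transversal segments `[-(m+k), n+k]`, `k ≥ 1`,
by the cup `[n+1, n+2]` and the transversal segments `[-(m+k), n+k+2]`. -/
def insertCup (n m : ℕ) (D : Set (ℤ × ℤ)) : Set (ℤ × ℤ) :=
  {s | s ∈ D ∧ ¬ ∃ k : ℕ, 0 < k ∧ s = (-((m : ℤ) + k), (n : ℤ) + k)} ∪
    {((n : ℤ) + 1, (n : ℤ) + 2)} ∪
    {s | ∃ k : ℕ, 0 < k ∧ s = (-((m : ℤ) + k), (n : ℤ) + k + 2)}

/-- Replacing, in a frieze of type `(n, m)`, the transversal segments `[-(m+k), n+k]`, `k ≥ 1`,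
by the cap `[-(m+2), -(m+1)]` and the transversal segments `[-(m+k+2), n+k]`. -/
def insertCap (n m : ℕ) (D : Set (ℤ × ℤ)) : Set (ℤ × ℤ) :=
  {s | s ∈ D ∧ ¬ ∃ k : ℕ, 0 < k ∧ s = (-((m : ℤ) + k), (n : ℤ) + k)} ∪
    {(-((m : ℤ) + 2), -((m : ℤ) + 1))} ∪
    {s | ∃ k : ℕ, 0 < k ∧ s = (-((m : ℤ) + k + 2), (n : ℤ) + k)}

/-! ### Auxiliary facts: friezes of finite type are closed under the operations above

A frieze is described by a Galois connection `(l, p)` on `ℕ`: two points are joined by a segment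
iff they have the same label. -/

/-- Auxiliary labelling of the points of a frieze. -/
def lab (l p : ℕ → ℕ) (a : ℤ) : ℕ × ℕ :=
  if 0 < a then (p ((a.natAbs - 1) / 2), a.natAbs / 2)
  else ((a.natAbs - 1) / 2, l (a.natAbs / 2))

/-- Auxiliary: the segments joining points with the same label. -/
def labSet (l p : ℕ → ℕ) : Set (ℤ × ℤ) :=
  {s | s.1 ≠ 0 ∧ s.2 ≠ 0 ∧ s.1 < s.2 ∧ lab l p s.1 = lab l p s.2}

lemma lab_pos {l p : ℕ → ℕ} {a : ℤ} (h : 0 < a) :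
    lab l p a = (p ((a.natAbs - 1) / 2), a.natAbs / 2) := by simp [lab, h]

lemma lab_neg {l p : ℕ → ℕ} {a : ℤ} (h : a < 0) :
    lab l p a = ((a.natAbs - 1) / 2, l (a.natAbs / 2)) := by
  simp [lab, not_lt.mpr h.le]

lemma lab_unique {l p : ℕ → ℕ} (gc : GaloisConnection l p) {a b c : ℤ} (ha : a ≠ 0) (hb : b ≠ 0)
    (hc : c ≠ 0) (hab : lab l p a = lab l p b) (hac : lab l p a = lab l p c) (h1 : a ≠ b)
    (h2 : a ≠ c) : b = c := by
  have G1 := gc (a.natAbs / 2) ((b.natAbs - 1) / 2)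
  have G2 := gc (a.natAbs / 2) ((c.natAbs - 1) / 2)
  have G3 := gc (b.natAbs / 2) ((a.natAbs - 1) / 2)
  have G4 := gc (b.natAbs / 2) ((c.natAbs - 1) / 2)
  have G5 := gc (c.natAbs / 2) ((a.natAbs - 1) / 2)
  have G6 := gc (c.natAbs / 2) ((b.natAbs - 1) / 2)
  rcases lt_or_gt_of_ne ha with ha | ha <;> rcases lt_or_gt_of_ne hb with hb | hb <;>
  rcases lt_or_gt_of_ne hc with hc | hc <;>
  simp only [lab_pos, lab_neg, ha, hb, hc, Prod.mk.injEq] at hab hac <;> omega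

lemma lab_exists {l p : ℕ → ℕ} (gc : GaloisConnection l p) {a : ℤ} (ha : a ≠ 0) :
    ∃ b : ℤ, b ≠ 0 ∧ b ≠ a ∧ lab l p a = lab l p b := by
  rcases lt_or_gt_of_ne ha with ha | ha
  · obtain ⟨k, hk⟩ : ∃ k : ℕ, a = -(2 * (k : ℤ) + 1) ∨ a = -(2 * (k : ℤ) + 2) :=
      ⟨(a.natAbs - 1) / 2, by omega⟩
    have hl : l k ≤ l (k + 1) := gc.monotone_l (Nat.le_succ k)
    rcases hk with hk | hk
    · by_cases h : l k = l (k + 1)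
      · refine ⟨-(2 * (k : ℤ) + 2), by omega, by omega, ?_⟩
        rw [lab_neg ha, lab_neg (by omega)]
        rw [show a.natAbs = 2 * k + 1 by omega,
          show (-(2 * (k : ℤ) + 2)).natAbs = 2 * k + 2 by omega]
        rw [show (2 * k + 1 - 1) / 2 = k by omega, show (2 * k + 2 - 1) / 2 = k by omega,
          show (2 * k + 1) / 2 = k by omega, show (2 * k + 2) / 2 = k + 1 by omega, h]
      · refine ⟨2 * (l k : ℤ) + 1, by omega, by omega, ?_⟩
        rw [lab_neg ha, lab_pos (by omega)]
        rw [show a.natAbs = 2 * k + 1 by omega,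
          show (2 * (l k : ℤ) + 1).natAbs = 2 * l k + 1 by omega]
        rw [show (2 * k + 1 - 1) / 2 = k by omega, show (2 * l k + 1 - 1) / 2 = l k by omega,
          show (2 * k + 1) / 2 = k by omega, show (2 * l k + 1) / 2 = l k by omega]
        have G1 : k ≤ p (l k) := gc.le_u_l k
        have G2 : ¬ k + 1 ≤ p (l k) := fun e => by
          have : l (k + 1) ≤ l k := (gc (k + 1) (l k)).2 e
          omega
        simp only [Prod.mk.injEq, and_true]
        omega
    · by_cases h : l k = l (k + 1)
      · refine ⟨-(2 * (k : ℤ) + 1), by omega, by omega, ?_⟩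
        rw [lab_neg ha, lab_neg (by omega)]
        rw [show a.natAbs = 2 * k + 2 by omega,
          show (-(2 * (k : ℤ) + 1)).natAbs = 2 * k + 1 by omega]
        rw [show (2 * k + 1 - 1) / 2 = k by omega, show (2 * k + 2 - 1) / 2 = k by omega,
          show (2 * k + 1) / 2 = k by omega, show (2 * k + 2) / 2 = k + 1 by omega, h]
      · obtain ⟨n, hn⟩ : ∃ n, l (k + 1) = n + 1 := ⟨l (k + 1) - 1, by omega⟩
        refine ⟨2 * (n : ℤ) + 2, by omega, by omega, ?_⟩
        rw [lab_neg ha, lab_pos (by omega)]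
        rw [show a.natAbs = 2 * k + 2 by omega,
          show (2 * (n : ℤ) + 2).natAbs = 2 * n + 2 by omega]
        rw [show (2 * k + 2 - 1) / 2 = k by omega, show (2 * n + 2 - 1) / 2 = n by omega,
          show (2 * k + 2) / 2 = k + 1 by omega, show (2 * n + 2) / 2 = n + 1 by omega]
        have G1 := gc k n
        have G2 := gc (k + 1) n
        simp only [Prod.mk.injEq]
        omega
  · obtain ⟨n, hn⟩ : ∃ n : ℕ, a = 2 * (n : ℤ) + 1 ∨ a = 2 * (n : ℤ) + 2 :=
      ⟨(a.natAbs - 1) / 2, by omega⟩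
    rcases hn with hn | hn
    · by_cases h : l (p n) = n
      · refine ⟨-(2 * (p n : ℤ) + 1), by omega, by omega, ?_⟩
        rw [lab_pos ha, lab_neg (by omega)]
        rw [show a.natAbs = 2 * n + 1 by omega,
          show (-(2 * (p n : ℤ) + 1)).natAbs = 2 * p n + 1 by omega]
        rw [show (2 * n + 1 - 1) / 2 = n by omega, show (2 * p n + 1 - 1) / 2 = p n by omega,
          show (2 * n + 1) / 2 = n by omega, show (2 * p n + 1) / 2 = p n by omega, h]
      · have G1 : l (p n) ≤ n := gc.l_u_le n
        have G2 := gc (p n) (n - 1)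
        have hm : p (n - 1) ≤ p n := gc.monotone_u (Nat.sub_le n 1)
        refine ⟨2 * (n : ℤ), by omega, by omega, ?_⟩
        rw [lab_pos ha, lab_pos (by omega)]
        rw [show a.natAbs = 2 * n + 1 by omega,
          show (2 * (n : ℤ)).natAbs = 2 * n by omega]
        rw [show (2 * n + 1 - 1) / 2 = n by omega, show (2 * n - 1) / 2 = n - 1 by omega,
          show (2 * n + 1) / 2 = n by omega, show (2 * n) / 2 = n by omega]
        simp only [Prod.mk.injEq, and_true]
        omega
    · have hm : p n ≤ p (n + 1) := gc.monotone_u (Nat.le_succ n)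
      by_cases h : p n = p (n + 1)
      · refine ⟨2 * (n : ℤ) + 3, by omega, by omega, ?_⟩
        rw [lab_pos ha, lab_pos (by omega)]
        rw [show a.natAbs = 2 * n + 2 by omega,
          show (2 * (n : ℤ) + 3).natAbs = 2 * n + 3 by omega]
        rw [show (2 * n + 2 - 1) / 2 = n by omega, show (2 * n + 3 - 1) / 2 = n + 1 by omega,
          show (2 * n + 2) / 2 = n + 1 by omega, show (2 * n + 3) / 2 = n + 1 by omega, h]
      · refine ⟨-(2 * (p n : ℤ) + 2), by omega, by omega, ?_⟩
        rw [lab_pos ha, lab_neg (by omega)]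
        rw [show a.natAbs = 2 * n + 2 by omega,
          show (-(2 * (p n : ℤ) + 2)).natAbs = 2 * p n + 2 by omega]
        rw [show (2 * n + 2 - 1) / 2 = n by omega, show (2 * p n + 2 - 1) / 2 = p n by omega,
          show (2 * n + 2) / 2 = n + 1 by omega, show (2 * p n + 2) / 2 = p n + 1 by omega]
        have G1 : ¬ l (p n + 1) ≤ n := fun e => by
          have : p n + 1 ≤ p n := (gc (p n + 1) n).1 e
          omega
        have G2 := gc (p n + 1) (n + 1)
        simp only [Prod.mk.injEq, true_and]
        omega

lemma labSet_exhausts {l p : ℕ → ℕ} (gc : GaloisConnection l p) {a : ℤ} (ha : a ≠ 0) :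
    ∃ s ∈ labSet l p, s.1 = a ∨ s.2 = a := by
  obtain ⟨b, hb, hba, h⟩ := lab_exists gc ha
  rcases lt_or_gt_of_ne hba with hlt | hlt
  · exact ⟨(b, a), ⟨hb, ha, hlt, h.symm⟩, .inr rfl⟩
  · exact ⟨(a, b), ⟨ha, hb, hlt, h⟩, .inl rfl⟩

lemma labSet_eq {l p : ℕ → ℕ} (gc : GaloisConnection l p) {D : Set (ℤ × ℤ)}
    (h1 : D ⊆ labSet l p) (h2 : ∀ a : ℤ, a ≠ 0 → ∃ s ∈ D, s.1 = a ∨ s.2 = a) :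
    D = labSet l p := by
  refine Set.Subset.antisymm h1 fun s hs => ?_
  obtain ⟨t, ht, h⟩ := h2 s.1 hs.1
  have ht' := h1 ht
  obtain ⟨s1, s2⟩ := s
  obtain ⟨t1, t2⟩ := t
  obtain ⟨a1, a2, a3, a4⟩ := hs
  obtain ⟨b1, b2, b3, b4⟩ := ht'
  simp only at *
  rcases h with rfl | rfl
  · have := lab_unique gc b1 a2 b2 a4 b4 (by omega) (by omega)
    subst this; exact ht
  · have := lab_unique gc b2 a2 b1 a4 b4.symm (by omega) (by omega)
    omega

lemma labSet_isFrieze {l p : ℕ → ℕ} (gc : GaloisConnection l p) : IsFrieze (labSet l p) where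
  isSeg s hs := ⟨hs.1, hs.2.1, hs.2.2.1⟩
  exhausts a ha := labSet_exhausts gc ha
  cup := by
    rintro ⟨a, b⟩ ⟨h1, h2, h3, h4⟩ h
    simp only at *
    rw [lab_pos h, lab_pos (by omega)] at h4
    simp only [Prod.mk.injEq] at h4 ⊢
    exact ⟨a.natAbs / 2 - 1, by omega⟩
  cap := by
    rintro ⟨a, b⟩ ⟨h1, h2, h3, h4⟩ h
    simp only at *
    rw [lab_neg h, lab_neg (by omega)] at h4
    simp only [Prod.mk.injEq] at h4 ⊢
    exact ⟨(a.natAbs - 1) / 2, by omega⟩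
  nonoverlapping := by
    rintro ⟨a, b⟩ ⟨h1, h2, h3, h4⟩ ⟨c, d⟩ ⟨k1, k2, k3, k4⟩ hne
    simp only [ne_eq, Prod.mk.injEq, not_and] at *
    have key : (b < c ∨ d < a) ∨ (a < c ∧ d < b) ∨ (c < a ∧ b < d) := by
      have e1 : a ≠ c := fun e => by
        subst e
        exact hne rfl (lab_unique gc h1 h2 k2 h4 k4 (by omega) (by omega))
      have e2 : a ≠ d := fun e => by
        subst e
        have := lab_unique gc h1 h2 k1 h4 k4.symm (by omega) (by omega)
        omega
      have e3 : b ≠ c := fun e => by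
        subst e
        have := lab_unique gc h2 h1 k2 h4.symm k4 (by omega) (by omega)
        omega
      have e4 : b ≠ d := fun e => by
        subst e
        exact e1 (lab_unique gc h2 h1 k1 h4.symm k4.symm (by omega) (by omega))
      have G1 := gc (a.natAbs / 2) ((b.natAbs - 1) / 2)
      have G2 := gc (a.natAbs / 2) ((d.natAbs - 1) / 2)
      have G3 := gc (c.natAbs / 2) ((b.natAbs - 1) / 2)
      have G4 := gc (c.natAbs / 2) ((d.natAbs - 1) / 2)
      rcases lt_or_gt_of_ne h1 with h1 | h1 <;> rcases lt_or_gt_of_ne h2 with h2 | h2 <;>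
      rcases lt_or_gt_of_ne k1 with k1 | k1 <;> rcases lt_or_gt_of_ne k2 with k2 | k2 <;>
      simp only [lab_pos, lab_neg, h1, h2, k1, k2, Prod.mk.injEq] at h4 k4 <;> omega
    rcases key with key | key | key
    · left
      rw [Set.disjoint_left]
      rintro z ⟨_, z1, z2⟩ ⟨_, z3, z4⟩
      simp only at *
      omega
    · exact .inr (.inl key)
    · exact .inr (.inr key)

lemma IsFrieze.share {D : Set (ℤ × ℤ)} (h : IsFrieze D) {s t : ℤ × ℤ} (hs : s ∈ D) (ht : t ∈ D)
    {a : ℤ} (h1 : s.1 = a ∨ s.2 = a) (h2 : t.1 = a ∨ t.2 = a) : s = t := by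
  by_contra hne
  have hs' := h.isSeg s hs
  have ht' := h.isSeg t ht
  rcases h.nonoverlapping s hs t ht hne with h3 | h3 | h3
  · have h4 := Set.disjoint_left.1 h3
    refine @h4 a ⟨?_, ?_, ?_⟩ ⟨?_, ?_, ?_⟩ <;> omega
  · have := h3.1; have := h3.2; omega
  · have := h3.1; have := h3.2; omega

lemma IsFrieze.noncross {D : Set (ℤ × ℤ)} (h : IsFrieze D) {s t : ℤ × ℤ} (hs : s ∈ D)
    (ht : t ∈ D) (s2 : 0 < s.2) (t1 : t.1 < 0) (hst : s.1 < t.1) : t.2 < s.2 := by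
  have hs' := h.isSeg s hs
  have ht' := h.isSeg t ht
  rcases h.nonoverlapping s hs t ht (by rintro rfl; omega) with h3 | h3 | h3
  · exfalso
    have h4 := Set.disjoint_left.1 h3
    refine @h4 t.1 ⟨?_, ?_, ?_⟩ ⟨?_, ?_, ?_⟩ <;> omega
  · exact h3.2
  · have := h3.1; omega

lemma IsFrieze.dichotomy {D : Set (ℤ × ℤ)} (h : IsFrieze D) (i n : ℕ) :
    (∃ s ∈ D, s.1 < 0 ∧ 0 < s.2 ∧ s.2 ≤ 2 * n + 1 ∧ s.1 ≤ -(2 * (i : ℤ) + 1)) ∨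
    (∃ s ∈ D, s.1 < 0 ∧ 0 < s.2 ∧ 2 * (n : ℤ) + 2 ≤ s.2 ∧ -(2 * (i : ℤ)) ≤ s.1) := by
  by_contra hcon
  push Not at hcon
  obtain ⟨hP, hQ⟩ := hcon
  choose! f hf hfa using h.exhausts
  let g : ℤ → ℤ := fun a => if (f a).1 = a then (f a).2 else (f a).1
  have hg : ∀ a, a ≠ 0 → g a ≠ a ∧ ((f a).1 = g a ∧ (f a).2 = a ∨ (f a).1 = a ∧ (f a).2 = g a) := by
    intro a ha
    have h1 := h.isSeg _ (hf a ha)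
    have h2 := hfa a ha
    simp only [g]
    split_ifs <;> omega
  let S : Finset ℤ := (Finset.Icc (-(2 * (i : ℤ))) (2 * n + 1)).erase 0
  have hS : ∀ a, a ∈ S ↔ a ≠ 0 ∧ -(2 * (i : ℤ)) ≤ a ∧ a ≤ 2 * n + 1 := by
    intro a; simp [S]
  have hgS : ∀ a, a ∈ S → g a ∈ S := by
    intro a ha
    rw [hS] at ha ⊢
    have h1 := h.isSeg _ (hf a ha.1)
    have h3 := hg a ha.1
    have h4 := hP _ (hf a ha.1)
    have h5 := hQ _ (hf a ha.1)
    rcases lt_or_gt_of_ne h1.1 with k1 | k1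
    · rcases lt_or_gt_of_ne h1.2.1 with k2 | k2
      · obtain ⟨k, hk⟩ := h.cap _ (hf a ha.1) k2
        rw [hk] at h3
        simp only at h3
        omega
      · have h4 := h4 k1 k2
        have h5 := h5 k1 k2
        omega
    · obtain ⟨k, hk⟩ := h.cup _ (hf a ha.1) k1
      rw [hk] at h3
      simp only at h3
      omega
  have hsum : ∑ a ∈ S, (1 : ZMod 2) = 0 := by
    refine Finset.sum_involution (fun a _ => g a) (fun _ _ => by decide)
      (fun a ha _ => (hg a ((hS a).1 ha).1).1) (fun a ha => hgS a ha) ?_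
    intro a ha
    have ha0 := ((hS a).1 ha).1
    have hb0 := ((hS _).1 (hgS a ha)).1
    have h3 := hg a ha0
    have h4 := hg _ hb0
    have : f a = f (g a) := h.share (hf a ha0) (hf _ hb0) (a := g a) (by omega) (by omega)
    rw [← this] at h4
    omega
  have hcard : S.card = 2 * (i + n) + 1 := by
    rw [Finset.card_erase_of_mem (by simp; omega), Int.card_Icc]
    omega
  rw [Finset.sum_const, hcard, nsmul_eq_mul, mul_one] at hsum
  have := (ZMod.natCast_eq_zero_iff _ _).1 hsum
  omega

lemma IsFrieze.exists_rep {D : Set (ℤ × ℤ)} (h : IsFrieze D) {n m : ℕ} (ht : HasType D n m) :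
    ∃ l p : ℕ → ℕ, GaloisConnection l p ∧ D = labSet l p := by
  classical
  let P : ℕ → ℕ → Prop := fun i j =>
    ∃ s ∈ D, s.1 < 0 ∧ 0 < s.2 ∧ s.2 ≤ 2 * j + 1 ∧ s.1 ≤ -(2 * (i : ℤ) + 1)
  let Q : ℕ → ℕ → Prop := fun i j =>
    ∃ s ∈ D, s.1 < 0 ∧ 0 < s.2 ∧ 2 * (j : ℤ) + 2 ≤ s.2 ∧ -(2 * (i : ℤ)) ≤ s.1
  have hPQ : ∀ i j, P i j ↔ ¬ Q i j := by
    intro i j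
    refine ⟨?_, fun hq => (h.dichotomy i j).resolve_right hq⟩
    rintro ⟨s, hs, a1, a2, a3, a4⟩ ⟨t, ht, b1, b2, b3, b4⟩
    have := h.noncross hs ht a2 b1 (by omega)
    omega
  have exP : ∀ i, ∃ j, P i j := fun i =>
    ⟨n + 2 * i + 1, _, ht (2 * i + 1) (by omega), by simp only; omega, by simp only; omega,
      by push_cast; omega, by push_cast; omega⟩
  have exQ : ∀ j, ∃ i, Q i j := fun j =>
    ⟨m + 2 * j + 2, _, ht (2 * j + 2) (by omega), by simp only; omega, by simp only; omega,
      by push_cast; omega, by push_cast; omega⟩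
  let l : ℕ → ℕ := fun i => Nat.find (exP i)
  let p : ℕ → ℕ := fun j => Nat.find (exQ j) - 1
  have hl : ∀ i j, l i ≤ j ↔ P i j := by
    intro i j
    simp only [l, Nat.find_le_iff]
    constructor
    · rintro ⟨k, hk, s, hs, a1, a2, a3, a4⟩
      exact ⟨s, hs, a1, a2, by omega, a4⟩
    · exact fun hp => ⟨j, le_rfl, hp⟩
  have hp : ∀ i j, i ≤ p j ↔ P i j := by
    intro i j
    have h0 : 0 < Nat.find (exQ j) := by
      rw [Nat.find_pos]
      rintro ⟨s, hs, a1, a2, a3, a4⟩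
      simp only [Nat.cast_zero] at a4
      omega
    rw [hPQ, show i ≤ p j ↔ i < Nat.find (exQ j) by simp only [p]; omega, Nat.lt_find_iff]
    constructor
    · exact fun hq => hq i le_rfl
    · rintro hq k hk ⟨s, hs, a1, a2, a3, a4⟩
      exact hq ⟨s, hs, a1, a2, a3, by omega⟩
  have gc : GaloisConnection l p := fun i j => (hl i j).trans (hp i j).symm
  refine ⟨l, p, gc, labSet_eq gc ?_ h.exhausts⟩
  intro s hs
  have hseg := h.isSeg s hs
  refine ⟨hseg.1, hseg.2.1, hseg.2.2, ?_⟩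
  rcases lt_or_gt_of_ne hseg.1 with k1 | k1
  · rcases lt_or_gt_of_ne hseg.2.1 with k2 | k2
    · obtain ⟨k, hk⟩ := h.cap s hs k2
      have e : l k = l (k + 1) := by
        refine eq_of_forall_ge_iff fun j => ?_
        rw [hl, hl]
        constructor
        · rintro ⟨t, ht, a1, a2, a3, a4⟩
          refine ⟨t, ht, a1, a2, a3, ?_⟩
          by_contra hlt
          push_cast at hlt
          have : s = t := h.share hs ht (a := t.1) (by rw [hk]; simp only; omega) (by omega)
          rw [← this] at a2
          omega
        · rintro ⟨t, ht, a1, a2, a3, a4⟩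
          push_cast at a4
          exact ⟨t, ht, a1, a2, a3, by omega⟩
      rw [lab_neg k1, lab_neg k2, hk]
      simp only
      rw [show (-(2 * (k : ℤ) + 2)).natAbs = 2 * k + 2 by omega,
        show (-(2 * (k : ℤ) + 1)).natAbs = 2 * k + 1 by omega,
        show (2 * k + 2) / 2 = k + 1 by omega, show (2 * k + 1) / 2 = k by omega, e,
        show (2 * k + 2 - 1) / 2 = k by omega, show (2 * k + 1 - 1) / 2 = k by omega]
    · rw [lab_neg k1, lab_pos k2, Prod.mk.injEq]
      have hyes : ∀ i j : ℕ, (s.2 ≤ 2 * j + 2 ∧ s.1 ≤ -(2 * (i : ℤ) + 1) ∨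
          s.2 ≤ 2 * j + 1 ∧ s.1 ≤ -(2 * (i : ℤ))) → P i j := by
        intro i j hij
        rw [hPQ]
        rintro ⟨t, ht, a1, a2, a3, a4⟩
        rcases lt_trichotomy s.1 t.1 with c | c | c
        · have := h.noncross hs ht k2 a1 c
          omega
        · have : s = t := h.share hs ht (a := s.1) (by simp) (by simp [c])
          subst this
          omega
        · omega
      have hno : ∀ i j : ℕ, (2 * (j : ℤ) + 1 ≤ s.2 ∧ -(2 * (i : ℤ)) ≤ s.1 ∨
          2 * (j : ℤ) + 2 ≤ s.2 ∧ -(2 * (i : ℤ) + 1) ≤ s.1) → ¬ P i j := by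
        rintro i j hij ⟨t, ht, a1, a2, a3, a4⟩
        rcases lt_trichotomy t.1 s.1 with c | c | c
        · have := h.noncross ht hs a2 k1 c
          omega
        · have : s = t := h.share hs ht (a := s.1) (by simp) (by simp [c])
          subst this
          omega
        · omega
      constructor
      · symm
        refine eq_of_forall_le_iff fun i => ?_
        rw [hp]
        constructor
        · intro hP
          by_contra hlt
          exact hno i _ (by omega) hP
        · intro hi
          exact hyes i _ (by omega)
      · refine eq_of_forall_ge_iff fun j => ?_
        rw [hl]
        constructor
        · intro hP
          by_contra hlt
          exact hno _ j (by omega) hP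
        · intro hi
          exact hyes _ j (by omega)
  · obtain ⟨k, hk⟩ := h.cup s hs k1
    have e : p k = p (k + 1) := by
      refine eq_of_forall_le_iff fun i => ?_
      rw [hp, hp]
      constructor
      · rintro ⟨t, ht, a1, a2, a3, a4⟩
        exact ⟨t, ht, a1, a2, by push_cast; omega, a4⟩
      · rintro ⟨t, ht, a1, a2, a3, a4⟩
        refine ⟨t, ht, a1, a2, ?_, a4⟩
        by_contra hlt
        push_cast at a3
        have : s = t := h.share hs ht (a := t.2) (by rw [hk]; simp only; omega) (by omega)
        rw [← this] at a1
        omega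
    rw [lab_pos k1, lab_pos (by omega), hk]
    simp only
    rw [show (2 * (k : ℤ) + 2).natAbs = 2 * k + 2 by omega,
      show (2 * (k : ℤ) + 3).natAbs = 2 * k + 3 by omega,
      show (2 * k + 2) / 2 = k + 1 by omega, show (2 * k + 3) / 2 = k + 1 by omega,
      show (2 * k + 2 - 1) / 2 = k by omega, show (2 * k + 3 - 1) / 2 = k + 1 by omega, e]

lemma mid_chain {l₁ p₁ l₂ p₂ : ℕ → ℕ} (gc₁ : GaloisConnection l₁ p₁)
    (gc₂ : GaloisConnection l₂ p₂) (d : ℕ) : ∀ x : ℕ, 0 < x →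
    p₂ ((x - 1) / 2) = p₂ ((x + d - 1) / 2) → l₁ (x / 2) = l₁ ((x + d) / 2) →
    Relation.EqvGen (Link (labSet l₂ p₂) (labSet l₁ p₁)) (.mid x) (.mid (x + d)) := by
  induction d with
  | zero => exact fun x _ _ _ => .refl _
  | succ d ih =>
    intro x hx h1 h2
    have a1 : p₂ ((x - 1) / 2) ≤ p₂ ((x + d - 1) / 2) := gc₂.monotone_u (by omega)
    have a2 : p₂ ((x + d - 1) / 2) ≤ p₂ ((x + (d + 1) - 1) / 2) := gc₂.monotone_u (by omega)
    have b1 : l₁ (x / 2) ≤ l₁ ((x + d) / 2) := gc₁.monotone_l (by omega)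
    have b2 : l₁ ((x + d) / 2) ≤ l₁ ((x + (d + 1)) / 2) := gc₁.monotone_l (by omega)
    refine .trans _ _ _ (ih x hx (by omega) (by omega)) ?_
    have e1 : p₂ ((x + d - 1) / 2) = p₂ ((x + d + 1 - 1) / 2) := by
      rw [add_assoc x d 1]; omega
    have e2 : l₁ ((x + d) / 2) = l₁ ((x + d + 1) / 2) := by rw [add_assoc x d 1]; omega
    have hy : 0 < x + d := by omega
    rw [← add_assoc x d 1]
    clear ih h1 h2 a1 a2 b1 b2
    generalize x + d = y at e1 e2 hy ⊢
    rcases Nat.even_or_odd' y with ⟨k, rfl | rfl⟩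
    · have := Link.low (D₂ := labSet l₂ p₂) (D₁ := labSet l₁ p₁)
        (2 * (k : ℤ), 2 * (k : ℤ) + 1) ⟨by simp only; omega, by simp only; omega, by simp, by
          rw [lab_pos (by simp only; omega), lab_pos (by simp only; omega), Prod.mk.injEq]
          simp only
          rw [show (2 * (k : ℤ) + 1).natAbs = 2 * k + 1 by omega,
            show (2 * (k : ℤ)).natAbs = 2 * k by omega]
          omega⟩
      simp only [lower] at this
      rw [if_pos (by omega), if_pos (by omega)] at this
      exact .rel _ _ this
    · have := Link.up (D₂ := labSet l₂ p₂) (D₁ := labSet l₁ p₁)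
        (-(2 * (k : ℤ) + 2), -(2 * (k : ℤ) + 1))
        ⟨by simp only; omega, by simp only; omega, by simp, by
          rw [lab_neg (by simp only; omega), lab_neg (by simp only; omega), Prod.mk.injEq]
          simp only
          rw [show (-(2 * (k : ℤ) + 1)).natAbs = 2 * k + 1 by omega,
            show (-(2 * (k : ℤ) + 2)).natAbs = 2 * k + 1 + 1 by omega]
          omega⟩
      simp only [upper] at this
      rw [if_neg (by omega), if_neg (by omega)] at this
      rw [show (-(2 * (k : ℤ) + 1)).natAbs = 2 * k + 1 by omega,
        show (-(2 * (k : ℤ) + 2)).natAbs = 2 * k + 1 + 1 by omega] at this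
      exact .symm _ _ (.rel _ _ this)

/-- Auxiliary labelling of the points of stacked diagrams. -/
def glab (l₁ p₁ l₂ p₂ : ℕ → ℕ) : Pt → ℕ × ℕ
  | .top x => (p₂ (p₁ ((x - 1) / 2)), x / 2)
  | .mid x => (p₂ ((x - 1) / 2), l₁ (x / 2))
  | .bot x => ((x - 1) / 2, l₁ (l₂ (x / 2)))

lemma glab_outer (l₁ p₁ l₂ p₂ : ℕ → ℕ) (a : ℤ) :
    glab l₁ p₁ l₂ p₂ (outer a) = lab (l₁ ∘ l₂) (p₂ ∘ p₁) a := by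
  unfold outer lab; split_ifs <;> rfl

lemma glab_upper (l₁ p₁ l₂ p₂ : ℕ → ℕ) (a : ℤ) :
    glab l₁ p₁ l₂ p₂ (upper a) = (p₂ (lab l₁ p₁ a).1, (lab l₁ p₁ a).2) := by
  unfold upper lab; split_ifs <;> rfl

lemma glab_lower (l₁ p₁ l₂ p₂ : ℕ → ℕ) (a : ℤ) :
    glab l₁ p₁ l₂ p₂ (lower a) = ((lab l₂ p₂ a).1, l₁ (lab l₂ p₂ a).2) := by
  unfold lower lab; split_ifs <;> rfl

lemma glab_eqv {l₁ p₁ l₂ p₂ : ℕ → ℕ} {x y : Pt}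
    (h : Relation.EqvGen (Link (labSet l₂ p₂) (labSet l₁ p₁)) x y) :
    glab l₁ p₁ l₂ p₂ x = glab l₁ p₁ l₂ p₂ y := by
  induction h with
  | rel x y h =>
    cases h with
    | up s hs => rw [glab_upper, glab_upper, hs.2.2.2]
    | low s hs => rw [glab_lower, glab_lower, hs.2.2.2]
  | refl => rfl
  | symm _ _ _ ih => exact ih.symm
  | trans _ _ _ _ _ ih1 ih2 => exact ih1.trans ih2

lemma eqv_of_lab {l₁ p₁ l₂ p₂ : ℕ → ℕ} (gc₁ : GaloisConnection l₁ p₁)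
    (gc₂ : GaloisConnection l₂ p₂) {a b : ℤ} (ha : a ≠ 0) (hb : b ≠ 0) (hab : a ≠ b)
    (h : lab (l₁ ∘ l₂) (p₂ ∘ p₁) a = lab (l₁ ∘ l₂) (p₂ ∘ p₁) b) :
    Relation.EqvGen (Link (labSet l₂ p₂) (labSet l₁ p₁)) (outer a) (outer b) := by
  set E := Relation.EqvGen (Link (labSet l₂ p₂) (labSet l₁ p₁)) with hE
  have key : ∀ a : ℤ, a ≠ 0 → (∃ x : ℕ, 0 < x ∧ E (outer a) (.mid x)) ∨
      ∃ b : ℤ, b ≠ 0 ∧ b ≠ a ∧ E (outer a) (outer b) := by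
    intro a ha
    rcases lt_or_gt_of_ne ha with h | h
    · obtain ⟨s, hs, hsa⟩ := labSet_exhausts gc₂ ha
      have e := Relation.EqvGen.rel _ _
        (Link.low (D₂ := labSet l₂ p₂) (D₁ := labSet l₁ p₁) s hs)
      obtain ⟨h1, h2, h3, -⟩ := hs
      have ho : outer a = lower a := by simp [outer, lower, not_lt.2 h.le]
      rw [ho]
      rcases hsa with rfl | rfl
      · rcases lt_or_gt_of_ne h2 with k | k
        · refine .inr ⟨s.2, h2, by omega, ?_⟩
          rwa [show outer s.2 = lower s.2 by simp [outer, lower, not_lt.2 k.le]]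
        · refine .inl ⟨s.2.natAbs, by omega, ?_⟩
          rwa [show Pt.mid s.2.natAbs = lower s.2 by simp [lower, k]]
      · refine .inr ⟨s.1, h1, by omega, ?_⟩
        rw [show outer s.1 = lower s.1 by simp [outer, lower, not_lt.2 (h3.trans h).le]]
        exact .symm _ _ e
    · obtain ⟨s, hs, hsa⟩ := labSet_exhausts gc₁ ha
      have e := Relation.EqvGen.rel _ _
        (Link.up (D₂ := labSet l₂ p₂) (D₁ := labSet l₁ p₁) s hs)
      obtain ⟨h1, h2, h3, -⟩ := hs
      have ho : outer a = upper a := by simp [outer, upper, h]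
      rw [ho]
      rcases hsa with rfl | rfl
      · refine .inr ⟨s.2, h2, by omega, ?_⟩
        rwa [show outer s.2 = upper s.2 by simp [outer, upper, lt_trans h h3]]
      · rcases lt_or_gt_of_ne h1 with k | k
        · refine .inl ⟨s.1.natAbs, by omega, ?_⟩
          rw [show Pt.mid s.1.natAbs = upper s.1 by simp [upper, not_lt.2 k.le]]
          exact .symm _ _ e
        · refine .inr ⟨s.1, h1, by omega, ?_⟩
          rw [show outer s.1 = upper s.1 by simp [outer, upper, k]]
          exact .symm _ _ e
  have gc : GaloisConnection (l₁ ∘ l₂) (p₂ ∘ p₁) := gc₂.compose gc₁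
  have direct : ∀ a b : ℤ, a ≠ 0 → b ≠ 0 → a ≠ b →
      lab (l₁ ∘ l₂) (p₂ ∘ p₁) a = lab (l₁ ∘ l₂) (p₂ ∘ p₁) b →
      (∃ c : ℤ, c ≠ 0 ∧ c ≠ a ∧ E (outer a) (outer c)) → E (outer a) (outer b) := by
    rintro a b ha hb hab h ⟨c, hc, hca, e⟩
    have := glab_eqv e
    rw [glab_outer, glab_outer] at this
    rwa [lab_unique gc ha hb hc h this hab hca.symm]
  rcases key a ha with ⟨x, hx, ex⟩ | h1
  · rcases key b hb with ⟨y, hy, ey⟩ | h1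
    · have e1 := glab_eqv ex
      have e2 := glab_eqv ey
      rw [glab_outer] at e1 e2
      have e3 := e1.symm.trans (h.trans e2)
      simp only [glab, Prod.mk.injEq] at e3
      refine .trans _ _ _ ex (.trans _ _ _ ?_ (.symm _ _ ey))
      rcases le_total x y with hxy | hxy
      · obtain ⟨d, rfl⟩ := Nat.exists_eq_add_of_le hxy
        exact mid_chain gc₁ gc₂ d x hx e3.1 e3.2
      · obtain ⟨d, rfl⟩ := Nat.exists_eq_add_of_le hxy
        exact .symm _ _ (mid_chain gc₁ gc₂ d y hy e3.1.symm e3.2.symm)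
    · exact .symm _ _ (direct b a hb ha hab.symm h.symm h1)
  · exact direct a b ha hb hab h h1

lemma glue_labSet {l₁ p₁ l₂ p₂ : ℕ → ℕ} (gc₁ : GaloisConnection l₁ p₁)
    (gc₂ : GaloisConnection l₂ p₂) :
    glue (labSet l₂ p₂) (labSet l₁ p₁) = labSet (l₁ ∘ l₂) (p₂ ∘ p₁) := by
  ext s
  constructor
  · rintro ⟨h1, h2, h3, h4⟩
    refine ⟨h1, h2, h3, ?_⟩
    have := glab_eqv h4
    rwa [glab_outer, glab_outer] at this
  · rintro ⟨h1, h2, h3, h4⟩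
    exact ⟨h1, h2, h3, eqv_of_lab gc₁ gc₂ h1 h2 h3.ne h4⟩

lemma glue_hasType {D₂ D₁ : Set (ℤ × ℤ)} {n m r : ℕ} (h₁ : HasType D₁ n m)
    (h₂ : HasType D₂ m r) : HasType (glue D₂ D₁) n r := by
  intro k hk
  refine ⟨by simp only; omega, by simp only; omega, by simp only; omega, ?_⟩
  have e1 := Link.up (D₂ := D₂) (D₁ := D₁) _ (h₁ k hk)
  have e2 := Link.low (D₂ := D₂) (D₁ := D₁) _ (h₂ k hk)
  simp only [upper, lower] at e1 e2
  rw [if_neg (by omega), if_pos (by omega)] at e1 e2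
  rw [show (-((m : ℤ) + k)).natAbs = ((m : ℤ) + k).natAbs by omega] at e1
  simp only [outer]
  rw [if_neg (by omega), if_pos (by omega)]
  exact .trans _ _ _ (.rel _ _ e2) (.rel _ _ e1)

lemma unitFrieze_eq : unitFrieze = labSet id id := by
  refine labSet_eq (fun _ _ => Iff.rfl) ?_ ?_
  · rintro _ ⟨k, rfl⟩
    refine ⟨by simp only; omega, by simp only; omega, by simp only; omega, ?_⟩
    rw [lab_neg (by simp only; omega), lab_pos (by simp only; omega)]
    simp only [Prod.mk.injEq]
    omega
  · intro a ha
    exact ⟨_, ⟨a.natAbs - 1, rfl⟩, by simp only; omega⟩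

lemma unitFrieze_hasType (n : ℕ) : HasType unitFrieze n n := by
  intro k hk
  exact ⟨n + k - 1, by
    rw [show ((n + k - 1 : ℕ) : ℤ) + 1 = n + k by omega]⟩

/-- Auxiliary: for a labelled frieze of type `(n, m)`, what the labels are from `n` on. -/
lemma type_eq {l p : ℕ → ℕ} {n m : ℕ} (h : HasType (labSet l p) n m) (k : ℕ) (hk : 0 < k) :
    p ((n + k - 1) / 2) = (m + k - 1) / 2 ∧ l ((m + k) / 2) = (n + k) / 2 := by
  have := (h k hk).2.2.2
  rw [lab_neg (by simp only; omega), lab_pos (by simp only; omega), Prod.mk.injEq] at this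
  simp only at this
  rw [show (-((m : ℤ) + k)).natAbs = m + k by omega,
    show ((n : ℤ) + k).natAbs = n + k by omega] at this
  exact ⟨this.1.symm, this.2⟩

lemma insertCup_labSet {l p : ℕ → ℕ} (gc : GaloisConnection l p) {n m q : ℕ} (hn : n = 2 * q + 1)
    (ht : HasType (labSet l p) n m) :
    ∃ l' : ℕ → ℕ, GaloisConnection l' (fun j => if j ≤ q then p j else p (j - 1)) ∧
      insertCup n m (labSet l p) = labSet l' (fun j => if j ≤ q then p j else p (j - 1)) := by
  have gc' : GaloisConnection (fun i => if l i ≤ q then l i else l i + 1)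
      (fun j => if j ≤ q then p j else p (j - 1)) := by
    intro i j
    have G1 := gc i j
    have G2 := gc i (j - 1)
    simp only
    split_ifs <;> omega
  refine ⟨_, gc', labSet_eq gc' ?_ ?_⟩
  · have T1 := (type_eq ht 1 one_pos).1
    rw [show (n + 1 - 1) / 2 = q by omega, show (m + 1 - 1) / 2 = m / 2 by omega] at T1
    rintro s ((⟨hs, hne⟩ | rfl) | ⟨k, hk, rfl⟩)
    · have hs' := hs
      obtain ⟨h1, h2, h3, h4⟩ := hs
      refine ⟨h1, h2, h3, ?_⟩
      have b1 : -(m : ℤ) ≤ s.1 := by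
        by_contra hlt
        refine hne ⟨s.1.natAbs - m, by omega, ?_⟩
        exact (labSet_isFrieze gc).share hs' (ht (s.1.natAbs - m) (by omega)) (a := s.1) (by simp)
          (by simp only; omega)
      have b2 : s.2 ≤ n := by
        by_contra hlt
        refine hne ⟨s.2.natAbs - n, by omega, ?_⟩
        exact (labSet_isFrieze gc).share hs' (ht (s.2.natAbs - n) (by omega)) (a := s.2) (by simp)
          (by simp only; omega)
      have pt : ∀ a : ℤ, a ≠ 0 → -(m : ℤ) ≤ a → a ≤ n →
          lab (fun i => if l i ≤ q then l i else l i + 1)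
            (fun j => if j ≤ q then p j else p (j - 1)) a = lab l p a := by
        intro a ha ha1 ha2
        rcases lt_or_gt_of_ne ha with h | h
        · have : l (a.natAbs / 2) ≤ q := (gc _ _).2 (by omega)
          rw [lab_neg h, lab_neg h, if_pos this]
        · rw [lab_pos h, lab_pos h, if_pos (by omega)]
      rw [pt _ h1 b1 (by omega), pt _ h2 (by omega) b2, h4]
    · refine ⟨by simp only; omega, by simp only; omega, by simp only; omega, ?_⟩
      rw [lab_pos (by simp only; omega), lab_pos (by simp only; omega), Prod.mk.injEq]
      simp only
      rw [show ((n : ℤ) + 1).natAbs = n + 1 by omega, show ((n : ℤ) + 2).natAbs = n + 2 by omega,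
        show (n + 1 - 1) / 2 = q by omega, show (n + 2 - 1) / 2 = q + 1 by omega,
        if_pos le_rfl, if_neg (by omega), Nat.add_sub_cancel]
      exact ⟨rfl, by omega⟩
    · refine ⟨by simp only; omega, by simp only; omega, by simp only; omega, ?_⟩
      obtain ⟨t1, t2⟩ := type_eq ht k hk
      rw [lab_neg (by simp only; omega), lab_pos (by simp only; omega), Prod.mk.injEq]
      simp only
      rw [show (-((m : ℤ) + k)).natAbs = m + k by omega,
        show ((n : ℤ) + k + 2).natAbs = n + k + 2 by omega, t2,
        if_neg (by omega), if_neg (by omega),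
        show (n + k + 2 - 1) / 2 - 1 = (n + k - 1) / 2 by omega, t1]
      exact ⟨rfl, by omega⟩
  · intro a ha
    obtain ⟨s, hs, hsa⟩ := labSet_exhausts gc ha
    by_cases h : ∃ k : ℕ, 0 < k ∧ s = (-((m : ℤ) + k), (n : ℤ) + k)
    · obtain ⟨k, hk, rfl⟩ := h
      simp only at hsa
      rcases hsa with rfl | rfl
      · exact ⟨_, .inr ⟨k, hk, rfl⟩, .inl rfl⟩
      · by_cases h2 : k ≤ 2
        · exact ⟨_, .inl (.inr rfl), by simp only; omega⟩
        · exact ⟨_, .inr ⟨k - 2, by omega, rfl⟩, .inr (by simp only; omega)⟩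
    · exact ⟨s, .inl (.inl ⟨hs, h⟩), hsa⟩

lemma insertCap_labSet {l p : ℕ → ℕ} (gc : GaloisConnection l p) {n m q : ℕ} (hm : m = 2 * q)
    (ht : HasType (labSet l p) n m) :
    ∃ l' : ℕ → ℕ, GaloisConnection l' (fun j => if p j < q then p j else p j + 1) ∧
      insertCap n m (labSet l p) = labSet l' (fun j => if p j < q then p j else p j + 1) := by
  have gc' : GaloisConnection (fun i => if i ≤ q then l i else l (i - 1))
      (fun j => if p j < q then p j else p j + 1) := by
    intro i j
    have G1 := gc i j
    have G2 := gc (i - 1) j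
    simp only
    split_ifs <;> omega
  refine ⟨_, gc', labSet_eq gc' ?_ ?_⟩
  · have T1 := (type_eq ht 1 one_pos).2
    rw [show (m + 1) / 2 = q by omega] at T1
    rintro s ((⟨hs, hne⟩ | rfl) | ⟨k, hk, rfl⟩)
    · have hs' := hs
      obtain ⟨h1, h2, h3, h4⟩ := hs
      refine ⟨h1, h2, h3, ?_⟩
      have b1 : -(m : ℤ) ≤ s.1 := by
        by_contra hlt
        refine hne ⟨s.1.natAbs - m, by omega, ?_⟩
        exact (labSet_isFrieze gc).share hs' (ht (s.1.natAbs - m) (by omega)) (a := s.1) (by simp)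
          (by simp only; omega)
      have b2 : s.2 ≤ n := by
        by_contra hlt
        refine hne ⟨s.2.natAbs - n, by omega, ?_⟩
        exact (labSet_isFrieze gc).share hs' (ht (s.2.natAbs - n) (by omega)) (a := s.2) (by simp)
          (by simp only; omega)
      have pt : ∀ a : ℤ, a ≠ 0 → -(m : ℤ) ≤ a → a ≤ n →
          lab (fun i => if i ≤ q then l i else l (i - 1))
            (fun j => if p j < q then p j else p j + 1) a = lab l p a := by
        intro a ha ha1 ha2
        rcases lt_or_gt_of_ne ha with h | h
        · rw [lab_neg h, lab_neg h, if_pos (by omega)]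
        · have : ¬ q ≤ p ((a.natAbs - 1) / 2) := fun e => by
            have := (gc _ _).2 e
            omega
          rw [lab_pos h, lab_pos h, if_pos (by omega)]
      rw [pt _ h1 b1 (by omega), pt _ h2 (by omega) b2, h4]
    · refine ⟨by simp only; omega, by simp only; omega, by simp only; omega, ?_⟩
      rw [lab_neg (by simp only; omega), lab_neg (by simp only; omega), Prod.mk.injEq]
      simp only
      rw [show (-((m : ℤ) + 1)).natAbs = m + 1 by omega,
        show (-((m : ℤ) + 2)).natAbs = m + 2 by omega,
        show (m + 1) / 2 = q by omega, show (m + 2) / 2 = q + 1 by omega,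
        if_pos le_rfl, if_neg (by omega), Nat.add_sub_cancel]
      exact ⟨by omega, rfl⟩
    · refine ⟨by simp only; omega, by simp only; omega, by simp only; omega, ?_⟩
      obtain ⟨t1, t2⟩ := type_eq ht k hk
      rw [lab_neg (by simp only; omega), lab_pos (by simp only; omega), Prod.mk.injEq]
      simp only
      rw [show (-((m : ℤ) + k + 2)).natAbs = m + k + 2 by omega,
        show ((n : ℤ) + k).natAbs = n + k by omega, t1,
        if_neg (by omega), if_neg (by omega),
        show (m + k + 2) / 2 - 1 = (m + k) / 2 by omega, t2]
      exact ⟨by omega, rfl⟩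
  · intro a ha
    obtain ⟨s, hs, hsa⟩ := labSet_exhausts gc ha
    by_cases h : ∃ k : ℕ, 0 < k ∧ s = (-((m : ℤ) + k), (n : ℤ) + k)
    · obtain ⟨k, hk, rfl⟩ := h
      simp only at hsa
      rcases hsa with rfl | rfl
      · by_cases h2 : k ≤ 2
        · exact ⟨_, .inl (.inr rfl), by simp only; omega⟩
        · exact ⟨_, .inr ⟨k - 2, by omega, rfl⟩, .inl (by simp only; omega)⟩
      · exact ⟨_, .inr ⟨k, hk, rfl⟩, .inr rfl⟩
    · exact ⟨s, .inl (.inl ⟨hs, h⟩), hsa⟩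

lemma insertCup_hasType {n m : ℕ} {D : Set (ℤ × ℤ)} : HasType (insertCup n m D) (n + 2) m := by
  intro k hk
  exact .inr ⟨k, hk, Prod.ext (by push_cast; omega) (by push_cast; omega)⟩

lemma insertCap_hasType {n m : ℕ} {D : Set (ℤ × ℤ)} : HasType (insertCap n m D) n (m + 2) := by
  intro k hk
  exact .inr ⟨k, hk, Prod.ext (by push_cast; omega) (by push_cast; omega)⟩

/-! ## The categories of friezes -/

/-- A frieze of type `(n, m)`, indexed by `(n, m)`. -/
@[ext]
structure FHom (n m : ℕ) : Type where
  segs : Set (ℤ × ℤ)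
  isFrieze : IsFrieze segs
  hasType : HasType segs n m

namespace FHom

lemma exists_rep {n m : ℕ} (D : FHom n m) :
    ∃ l p : ℕ → ℕ, GaloisConnection l p ∧ D.segs = labSet l p :=
  D.isFrieze.exists_rep D.hasType

/-- The unit frieze indexed by `(n, n)`. -/
def unit (n : ℕ) : FHom n n where
  segs := unitFrieze
  isFrieze := unitFrieze_eq ▸ labSet_isFrieze (fun _ _ => Iff.rfl)
  hasType := unitFrieze_hasType n

/-- The composition `D₂ ∘ D₁` of friezes of finite type. -/
def comp {n m r : ℕ} (D₂ : FHom m r) (D₁ : FHom n m) : FHom n r where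
  segs := glue D₂.segs D₁.segs
  isFrieze := by
    obtain ⟨l₁, p₁, g₁, h₁⟩ := D₁.exists_rep
    obtain ⟨l₂, p₂, g₂, h₂⟩ := D₂.exists_rep
    rw [h₁, h₂, glue_labSet g₁ g₂]
    exact labSet_isFrieze (g₂.compose g₁)
  hasType := glue_hasType D₁.hasType D₂.hasType

/-- The same frieze with its index `(n, m)` replaced by `(n+1, m+1)`. -/
def shift {n m : ℕ} (D : FHom n m) : FHom (n + 1) (m + 1) where
  segs := D.segs
  isFrieze := D.isFrieze
  hasType k hk := by
    have := D.hasType (k + 1) (by omega)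
    push_cast at this ⊢
    rwa [show (m : ℤ) + 1 + k = m + (k + 1) by ring, show (n : ℤ) + 1 + k = n + (k + 1) by ring]

/-- The operation on friezes corresponding to `φᵃ`. -/
def addCup {n m : ℕ} (hn : Odd n) (D : FHom n m) : FHom (n + 2) m where
  segs := insertCup n m D.segs
  isFrieze := by
    obtain ⟨l, p, g, h⟩ := D.exists_rep
    obtain ⟨q, hq⟩ := hn
    obtain ⟨l', g', h'⟩ := insertCup_labSet g hq (h ▸ D.hasType)
    rw [h, h']
    exact labSet_isFrieze g'
  hasType := insertCup_hasType

/-- The operation on friezes corresponding to `γᶜ`. -/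
def addCap {n m : ℕ} (hm : Even m) (D : FHom n m) : FHom n (m + 2) where
  segs := insertCap n m D.segs
  isFrieze := by
    obtain ⟨l, p, g, h⟩ := D.exists_rep
    obtain ⟨q, hq⟩ := hm
    obtain ⟨l', g', h'⟩ := insertCap_labSet g (hq.trans (two_mul q).symm) (h ▸ D.hasType)
    rw [h, h']
    exact labSet_isFrieze g'
  hasType := insertCap_hasType

/-- Auxiliary: the frieze `D` is described by the function `p`. -/
def Rep {n m : ℕ} (D : FHom n m) (p : ℕ → ℕ) : Prop :=
  ∃ l : ℕ → ℕ, GaloisConnection l p ∧ D.segs = labSet l p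

lemma Rep.eq {n m : ℕ} {D D' : FHom n m} {p p' : ℕ → ℕ} (h : D.Rep p) (h' : D'.Rep p')
    (e : ∀ j, p j = p' j) : D = D' := by
  obtain rfl : p = p' := funext e
  obtain ⟨l, g, hl⟩ := h
  obtain ⟨l', g', hl'⟩ := h'
  obtain rfl : l = l' := funext fun i => g.l_unique g' fun _ => rfl
  ext1
  rw [hl, hl']

lemma exists_fn {n m : ℕ} (D : FHom n m) : ∃ p, D.Rep p :=
  let ⟨l, p, h⟩ := D.exists_rep
  ⟨p, l, h⟩

lemma Rep.mono {n m : ℕ} {D : FHom n m} {p : ℕ → ℕ} (h : D.Rep p) : Monotone p :=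
  let ⟨_, g, _⟩ := h
  g.monotone_u

lemma Rep.tail {n m : ℕ} {D : FHom n m} {p : ℕ → ℕ} (h : D.Rep p) (k : ℕ) (hk : 0 < k) :
    p ((n + k - 1) / 2) = (m + k - 1) / 2 := by
  obtain ⟨l, g, hl⟩ := h
  exact (type_eq (hl ▸ D.hasType) k hk).1

lemma Rep.lt {n m : ℕ} {D : FHom n m} {p : ℕ → ℕ} (h : D.Rep p) {j : ℕ} (hj : j < (n + 1) / 2) :
    p j < (m + 1) / 2 := by
  obtain ⟨l, g, hl⟩ := h
  have h1 := (type_eq (hl ▸ D.hasType) 1 one_pos).2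
  by_contra hlt
  have h2 : l ((m + 1) / 2) ≤ j := (g _ _).2 (by omega)
  omega

lemma Rep.unit (n : ℕ) : (unit n).Rep id := ⟨id, fun _ _ => Iff.rfl, unitFrieze_eq⟩

lemma Rep.comp {n m r : ℕ} {D₂ : FHom m r} {D₁ : FHom n m} {p₂ p₁ : ℕ → ℕ} (h₂ : D₂.Rep p₂)
    (h₁ : D₁.Rep p₁) : (D₂.comp D₁).Rep (fun j => p₂ (p₁ j)) := by
  obtain ⟨l₁, g₁, e₁⟩ := h₁
  obtain ⟨l₂, g₂, e₂⟩ := h₂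
  refine ⟨l₁ ∘ l₂, g₂.compose g₁, ?_⟩
  change glue D₂.segs D₁.segs = _
  rw [e₁, e₂, glue_labSet g₁ g₂]
  rfl

lemma Rep.shift {n m : ℕ} {D : FHom n m} {p : ℕ → ℕ} (h : D.Rep p) : D.shift.Rep p := h

lemma Rep.addCup {n m : ℕ} {hn : Odd n} {D : FHom n m} {p : ℕ → ℕ} (h : D.Rep p) :
    (D.addCup hn).Rep (fun j => if j ≤ n / 2 then p j else p (j - 1)) := by
  obtain ⟨l, g, e⟩ := h
  obtain ⟨l', g', h'⟩ := insertCup_labSet g (q := n / 2) (by obtain ⟨q, hq⟩ := hn; omega)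
    (e ▸ D.hasType)
  refine ⟨l', g', ?_⟩
  rw [← h', ← e]
  rfl

lemma Rep.addCap {n m : ℕ} {hm : Even m} {D : FHom n m} {p : ℕ → ℕ} (h : D.Rep p) :
    (D.addCap hm).Rep (fun j => if p j < m / 2 then p j else p j + 1) := by
  obtain ⟨l, g, e⟩ := h
  obtain ⟨l', g', h'⟩ := insertCap_labSet g (q := m / 2) (by obtain ⟨q, hq⟩ := hm; omega)
    (e ▸ D.hasType)
  refine ⟨l', g', ?_⟩
  rw [← h', ← e]
  rfl

lemma comp_unit {n m : ℕ} (D : FHom n m) : D.comp (unit n) = D := by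
  obtain ⟨p, h⟩ := D.exists_fn
  exact (h.comp (.unit n)).eq h fun _ => rfl

lemma unit_comp {n m : ℕ} (D : FHom n m) : (unit m).comp D = D := by
  obtain ⟨p, h⟩ := D.exists_fn
  exact ((Rep.unit m).comp h).eq h fun _ => rfl

lemma comp_assoc {n m r t : ℕ} (D₃ : FHom r t) (D₂ : FHom m r) (D₁ : FHom n m) :
    D₃.comp (D₂.comp D₁) = (D₃.comp D₂).comp D₁ := by
  obtain ⟨p₁, h₁⟩ := D₁.exists_fn
  obtain ⟨p₂, h₂⟩ := D₂.exists_fn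
  obtain ⟨p₃, h₃⟩ := D₃.exists_fn
  exact (h₃.comp (h₂.comp h₁)).eq ((h₃.comp h₂).comp h₁) fun _ => rfl

end FHom

/-- The objects of the category `D_A`: the odd natural numbers. -/
structure DA : Type where
  val : ℕ
  odd : Odd val

/-- The objects of the category `D_B`: the even natural numbers. -/
structure DB : Type where
  val : ℕ
  even : Even val

/-- The category `D_A`: its arrows from `n` to `m` are the friezes of type `(n, m)`. -/
instance : Category DA where
  Hom n m := FHom n.val m.val
  id n := FHom.unit n.val
  comp f g := FHom.comp g f
  id_comp := FHom.comp_unit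
  comp_id := FHom.unit_comp
  assoc f g h := FHom.comp_assoc h g f

/-- The category `D_B`: its arrows from `n` to `m` are the friezes of type `(n, m)`. -/
instance : Category DB where
  Hom n m := FHom n.val m.val
  id n := FHom.unit n.val
  comp f g := FHom.comp g f
  id_comp := FHom.comp_unit
  comp_id := FHom.unit_comp
  assoc f g h := FHom.comp_assoc h g f

/-! ## The free adjunction generated by `(0, 1)` -/

mutual
/-- The objects of `A`: the words `F(GF)ⁿ∅`. -/
inductive ObjA : Type
  | F (b : ObjB) : ObjA
/-- The objects of `B`: the words `(GF)ⁿ∅`; `ObjB.gen` is the generator `∅`. -/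
inductive ObjB : Type
  | gen : ObjB
  | G (a : ObjA) : ObjB
end

mutual
/-- The arrow terms of `A`. -/
inductive TermA : ObjA → ObjA → Type
  | one (a : ObjA) : TermA a a
  | comp {a₁ a₂ a₃ : ObjA} (f₂ : TermA a₂ a₃) (f₁ : TermA a₁ a₂) : TermA a₁ a₃
  | F {b₁ b₂ : ObjB} (g : TermB b₁ b₂) : TermA (.F b₁) (.F b₂)
  | phi {a₁ a₂ : ObjA} (f : TermA a₁ a₂) : TermA (.F (.G a₁)) a₂
/-- The arrow terms of `B`. -/
inductive TermB : ObjB → ObjB → Type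
  | one (b : ObjB) : TermB b b
  | comp {b₁ b₂ b₃ : ObjB} (g₂ : TermB b₂ b₃) (g₁ : TermB b₁ b₂) : TermB b₁ b₃
  | G {a₁ a₂ : ObjA} (f : TermA a₁ a₂) : TermB (.G a₁) (.G a₂)
  | gamma {b₁ b₂ : ObjB} (g : TermB b₁ b₂) : TermB b₁ (.G (.F b₂))
end

mutual
/-- Equality of terms of `A`: the congruence generated by the equations of adjunctions. -/
inductive EqA : {a₁ a₂ : ObjA} → TermA a₁ a₂ → TermA a₁ a₂ → Prop
  | refl {a₁ a₂ : ObjA} (f : TermA a₁ a₂) : EqA f f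
  | symm {a₁ a₂ : ObjA} {f f' : TermA a₁ a₂} : EqA f f' → EqA f' f
  | trans {a₁ a₂ : ObjA} {f f' f'' : TermA a₁ a₂} : EqA f f' → EqA f' f'' → EqA f f''
  | congr_comp {a₁ a₂ a₃ : ObjA} {f₂ f₂' : TermA a₂ a₃} {f₁ f₁' : TermA a₁ a₂} :
      EqA f₂ f₂' → EqA f₁ f₁' → EqA (f₂.comp f₁) (f₂'.comp f₁')
  | congr_F {b₁ b₂ : ObjB} {g g' : TermB b₁ b₂} : EqB g g' → EqA (.F g) (.F g')
  | congr_phi {a₁ a₂ : ObjA} {f f' : TermA a₁ a₂} : EqA f f' → EqA (.phi f) (.phi f')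
  | comp_one {a₁ a₂ : ObjA} (f : TermA a₁ a₂) : EqA (f.comp (.one a₁)) f
  | one_comp {a₁ a₂ : ObjA} (f : TermA a₁ a₂) : EqA ((TermA.one a₂).comp f) f
  | assoc {a₁ a₂ a₃ a₄ : ObjA} (f₃ : TermA a₃ a₄) (f₂ : TermA a₂ a₃) (f₁ : TermA a₁ a₂) :
      EqA (f₃.comp (f₂.comp f₁)) ((f₃.comp f₂).comp f₁)
  | fun_one (b : ObjB) : EqA (.F (.one b)) (.one (.F b))
  | fun_comp {b₁ b₂ b₃ : ObjB} (g₂ : TermB b₂ b₃) (g₁ : TermB b₁ b₂) :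
      EqA ((TermA.F g₂).comp (.F g₁)) (.F (g₂.comp g₁))
  | nat₁ {a₁ a₂ a₃ : ObjA} (f₂ : TermA a₂ a₃) (f₁ : TermA a₁ a₂) :
      EqA (f₂.comp (.phi f₁)) (.phi (f₂.comp f₁))
  | nat₂ {a₁ a₂ a₃ : ObjA} (f₂ : TermA a₂ a₃) (f₁ : TermA a₁ a₂) :
      EqA ((TermA.phi f₂).comp (.F (.G f₁))) (.phi (f₂.comp f₁))
  | phi_gamma {b₁ b₂ : ObjB} {a : ObjA} (f : TermA (.F b₂) a) (g : TermB b₁ b₂) :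
      EqA ((TermA.phi f).comp (.F (.gamma g))) (f.comp (.F g))
/-- Equality of terms of `B`: the congruence generated by the equations of adjunctions. -/
inductive EqB : {b₁ b₂ : ObjB} → TermB b₁ b₂ → TermB b₁ b₂ → Prop
  | refl {b₁ b₂ : ObjB} (g : TermB b₁ b₂) : EqB g g
  | symm {b₁ b₂ : ObjB} {g g' : TermB b₁ b₂} : EqB g g' → EqB g' g
  | trans {b₁ b₂ : ObjB} {g g' g'' : TermB b₁ b₂} : EqB g g' → EqB g' g'' → EqB g g''
  | congr_comp {b₁ b₂ b₃ : ObjB} {g₂ g₂' : TermB b₂ b₃} {g₁ g₁' : TermB b₁ b₂} :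
      EqB g₂ g₂' → EqB g₁ g₁' → EqB (g₂.comp g₁) (g₂'.comp g₁')
  | congr_G {a₁ a₂ : ObjA} {f f' : TermA a₁ a₂} : EqA f f' → EqB (.G f) (.G f')
  | congr_gamma {b₁ b₂ : ObjB} {g g' : TermB b₁ b₂} : EqB g g' → EqB (.gamma g) (.gamma g')
  | comp_one {b₁ b₂ : ObjB} (g : TermB b₁ b₂) : EqB (g.comp (.one b₁)) g
  | one_comp {b₁ b₂ : ObjB} (g : TermB b₁ b₂) : EqB ((TermB.one b₂).comp g) g
  | assoc {b₁ b₂ b₃ b₄ : ObjB} (g₃ : TermB b₃ b₄) (g₂ : TermB b₂ b₃) (g₁ : TermB b₁ b₂) :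
      EqB (g₃.comp (g₂.comp g₁)) ((g₃.comp g₂).comp g₁)
  | fun_one (a : ObjA) : EqB (.G (.one a)) (.one (.G a))
  | fun_comp {a₁ a₂ a₃ : ObjA} (f₂ : TermA a₂ a₃) (f₁ : TermA a₁ a₂) :
      EqB ((TermB.G f₂).comp (.G f₁)) (.G (f₂.comp f₁))
  | nat₁ {b₁ b₂ b₃ : ObjB} (g₂ : TermB b₂ b₃) (g₁ : TermB b₁ b₂) :
      EqB ((TermB.gamma g₂).comp g₁) (.gamma (g₂.comp g₁))
  | nat₂ {b₁ b₂ b₃ : ObjB} (g₂ : TermB b₂ b₃) (g₁ : TermB b₁ b₂) :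
      EqB ((TermB.G (.F g₂)).comp (.gamma g₁)) (.gamma (g₂.comp g₁))
  | phi_gamma {a₁ a₂ : ObjA} {b : ObjB} (f : TermA a₁ a₂) (g : TermB b (.G a₁)) :
      EqB ((TermB.G (.phi f)).comp (.gamma g)) ((TermB.G f).comp g)
end

/-- Terms of `A` modulo equality. -/
instance termASetoid (a₁ a₂ : ObjA) : Setoid (TermA a₁ a₂) :=
  ⟨EqA, EqA.refl, EqA.symm, EqA.trans⟩

/-- Terms of `B` modulo equality. -/
instance termBSetoid (b₁ b₂ : ObjB) : Setoid (TermB b₁ b₂) :=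
  ⟨EqB, EqB.refl, EqB.symm, EqB.trans⟩

/-- The category `A` of the free adjunction: its arrows are equivalence classes of terms. -/
instance : Category ObjA where
  Hom a₁ a₂ := Quotient (termASetoid a₁ a₂)
  id a := ⟦.one a⟧
  comp f g := Quotient.map₂ (fun f g => TermA.comp g f) (fun _ _ h _ _ h' => .congr_comp h' h) f g
  id_comp := by rintro _ _ ⟨f⟩; exact Quotient.sound (.comp_one f)
  comp_id := by rintro _ _ ⟨f⟩; exact Quotient.sound (.one_comp f)
  assoc := by rintro _ _ _ _ ⟨f⟩ ⟨g⟩ ⟨h⟩; exact Quotient.sound (.assoc h g f)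

/-- The category `B` of the free adjunction: its arrows are equivalence classes of terms. -/
instance : Category ObjB where
  Hom b₁ b₂ := Quotient (termBSetoid b₁ b₂)
  id b := ⟦.one b⟧
  comp f g := Quotient.map₂ (fun f g => TermB.comp g f) (fun _ _ h _ _ h' => .congr_comp h' h) f g
  id_comp := by rintro _ _ ⟨f⟩; exact Quotient.sound (.comp_one f)
  comp_id := by rintro _ _ ⟨f⟩; exact Quotient.sound (.one_comp f)
  assoc := by rintro _ _ _ _ ⟨f⟩ ⟨g⟩ ⟨h⟩; exact Quotient.sound (.assoc h g f)

mutual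
/-- A term of `A` in normal form: composition-free, and its only identity is that of the
generator `∅` of `B`. -/
def TermA.IsNormal : {a₁ a₂ : ObjA} → TermA a₁ a₂ → Prop
  | _, _, .one _ => False
  | _, _, .comp _ _ => False
  | _, _, .F g => g.IsNormal
  | _, _, .phi f => f.IsNormal
/-- A term of `B` in normal form: composition-free, and its only identity is that of the
generator `∅` of `B`. -/
def TermB.IsNormal : {b₁ b₂ : ObjB} → TermB b₁ b₂ → Prop
  | _, _, .one b => b = .gen
  | _, _, .comp _ _ => False
  | _, _, .G f => f.IsNormal
  | _, _, .gamma g => g.IsNormal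
end

/-! ## The functors `E_A` and `E_B` -/

mutual
/-- `E_A` on objects: `F(GF)ⁿ∅` goes to `2n+1`. -/
def ObjA.num : ObjA → ℕ
  | .F b => b.num + 1
/-- `E_B` on objects: `(GF)ⁿ∅` goes to `2n`. -/
def ObjB.num : ObjB → ℕ
  | .gen => 0
  | .G a => a.num + 1
end

mutual
theorem ObjA.odd_num : (a : ObjA) → Odd a.num
  | .F b => b.even_num.add_one
theorem ObjB.even_num : (b : ObjB) → Even b.num
  | .gen => Even.zero
  | .G a => a.odd_num.add_one
end

mutual
/-- `E_A` on arrow terms. -/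
def TermA.frieze : {a₁ a₂ : ObjA} → TermA a₁ a₂ → FHom a₁.num a₂.num
  | _, _, .one a => FHom.unit a.num
  | _, _, .comp f₂ f₁ => f₂.frieze.comp f₁.frieze
  | _, _, .F g => g.frieze.shift
  | _, _, .phi (a₁ := a₁) f => f.frieze.addCup a₁.odd_num
/-- `E_B` on arrow terms. -/
def TermB.frieze : {b₁ b₂ : ObjB} → TermB b₁ b₂ → FHom b₁.num b₂.num
  | _, _, .one b => FHom.unit b.num
  | _, _, .comp g₂ g₁ => g₂.frieze.comp g₁.frieze
  | _, _, .G f => f.frieze.shift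
  | _, _, .gamma (b₂ := b₂) g => g.frieze.addCap b₂.even_num
end

mutual
theorem EqA.frieze_eq : {a₁ a₂ : ObjA} → {f f' : TermA a₁ a₂} → EqA f f' → f.frieze = f'.frieze
  | _, _, _, _, .refl f => rfl
  | _, _, _, _, .symm h => h.frieze_eq.symm
  | _, _, _, _, .trans h h' => h.frieze_eq.trans h'.frieze_eq
  | _, _, _, _, .congr_comp h h' => by simp only [TermA.frieze, h.frieze_eq, h'.frieze_eq]
  | _, _, _, _, .congr_F h => congrArg FHom.shift h.frieze_eq
  | _, _, _, _, .congr_phi h => congrArg (FHom.addCup _) h.frieze_eq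
  | _, _, _, _, .comp_one f => f.frieze.comp_unit
  | _, _, _, _, .one_comp f => f.frieze.unit_comp
  | _, _, _, _, .assoc f₃ f₂ f₁ => FHom.comp_assoc _ _ _
  | _, _, _, _, .fun_one b => rfl
  | _, _, _, _, .fun_comp g₂ g₁ => rfl
  | _, _, _, _, .nat₁ f₂ f₁ => by
    obtain ⟨p₁, h₁⟩ := f₁.frieze.exists_fn
    obtain ⟨p₂, h₂⟩ := f₂.frieze.exists_fn
    exact (h₂.comp h₁.addCup).eq (h₂.comp h₁).addCup fun j => by split_ifs <;> rfl
  | _, _, _, _, .nat₂ (a₁ := a₁) (a₂ := a₂) f₂ f₁ => by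
    obtain ⟨p₁, h₁⟩ := f₁.frieze.exists_fn
    obtain ⟨p₂, h₂⟩ := f₂.frieze.exists_fn
    refine (h₂.addCup.comp h₁.shift.shift).eq (h₂.comp h₁).addCup fun j => ?_
    obtain ⟨s, hs⟩ := a₁.odd_num
    obtain ⟨t, ht⟩ := a₂.odd_num
    by_cases hj : j ≤ a₁.num / 2
    · have e1 := h₁.mono hj
      have e2 := h₁.tail 1 one_pos
      rw [show (a₁.num + 1 - 1) / 2 = a₁.num / 2 by omega] at e2
      rw [if_pos hj, if_pos (by omega)]
    · obtain ⟨d, rfl⟩ := Nat.exists_eq_add_of_lt (not_le.1 hj)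
      have e2 := h₁.tail (2 * d + 1) (by omega)
      have e3 := h₁.tail (2 * d + 3) (by omega)
      rw [show (a₁.num + (2 * d + 1) - 1) / 2 = a₁.num / 2 + d by omega] at e2
      rw [show (a₁.num + (2 * d + 3) - 1) / 2 = a₁.num / 2 + d + 1 by omega] at e3
      rw [if_neg hj, if_neg (by omega), Nat.add_sub_cancel, e2, e3]
      congr 1
      omega
  | _, _, _, _, .phi_gamma (b₂ := b₂) f g => by
    obtain ⟨p₁, h₁⟩ := g.frieze.exists_fn
    obtain ⟨p₂, h₂⟩ := f.frieze.exists_fn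
    refine (h₂.addCup.comp h₁.addCap.shift).eq (h₂.comp h₁.shift) fun j => ?_
    have e : (ObjA.F b₂).num = b₂.num + 1 := rfl
    obtain ⟨s, hs⟩ := b₂.even_num
    rw [e]
    by_cases hj : p₁ j < b₂.num / 2
    · rw [if_pos hj, if_pos (by omega)]
    · rw [if_neg hj, if_neg (by omega), Nat.add_sub_cancel]
theorem EqB.frieze_eq : {b₁ b₂ : ObjB} → {g g' : TermB b₁ b₂} → EqB g g' → g.frieze = g'.frieze
  | _, _, _, _, .refl f => rfl
  | _, _, _, _, .symm h => h.frieze_eq.symm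
  | _, _, _, _, .trans h h' => h.frieze_eq.trans h'.frieze_eq
  | _, _, _, _, .congr_comp h h' => by simp only [TermB.frieze, h.frieze_eq, h'.frieze_eq]
  | _, _, _, _, .congr_G h => congrArg FHom.shift h.frieze_eq
  | _, _, _, _, .congr_gamma h => congrArg (FHom.addCap _) h.frieze_eq
  | _, _, _, _, .comp_one f => f.frieze.comp_unit
  | _, _, _, _, .one_comp f => f.frieze.unit_comp
  | _, _, _, _, .assoc f₃ f₂ f₁ => FHom.comp_assoc _ _ _
  | _, _, _, _, .fun_one b => rfl
  | _, _, _, _, .fun_comp g₂ g₁ => rfl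
  | _, _, _, _, .nat₁ g₂ g₁ => by
    obtain ⟨p₁, h₁⟩ := g₁.frieze.exists_fn
    obtain ⟨p₂, h₂⟩ := g₂.frieze.exists_fn
    exact (h₂.addCap.comp h₁).eq (h₂.comp h₁).addCap fun j => rfl
  | _, _, _, _, .nat₂ (b₂ := b₂) (b₃ := b₃) g₂ g₁ => by
    obtain ⟨p₁, h₁⟩ := g₁.frieze.exists_fn
    obtain ⟨p₂, h₂⟩ := g₂.frieze.exists_fn
    refine (h₂.shift.shift.comp h₁.addCap).eq (h₂.comp h₁).addCap fun j => ?_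
    obtain ⟨s, hs⟩ := b₂.even_num
    obtain ⟨t, ht⟩ := b₃.even_num
    by_cases hj : p₁ j < b₂.num / 2
    · have e1 := h₂.lt (j := p₁ j) (by omega)
      rw [if_pos hj, if_pos (by omega)]
    · obtain ⟨d, hd⟩ := Nat.exists_eq_add_of_le (not_lt.1 hj)
      have e2 := h₂.tail (2 * d + 1) (by omega)
      have e3 := h₂.tail (2 * d + 3) (by omega)
      rw [show (b₂.num + (2 * d + 1) - 1) / 2 = b₂.num / 2 + d by omega] at e2
      rw [show (b₂.num + (2 * d + 3) - 1) / 2 = b₂.num / 2 + d + 1 by omega] at e3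
      rw [if_neg hj, hd, e2, e3, if_neg (by omega)]
      omega
  | _, _, _, _, .phi_gamma (a₁ := a₁) f g => by
    obtain ⟨p₁, h₁⟩ := g.frieze.exists_fn
    obtain ⟨p₂, h₂⟩ := f.frieze.exists_fn
    refine (h₂.addCup.shift.comp h₁.addCap).eq (h₂.shift.comp h₁) fun j => ?_
    have e : (ObjB.G a₁).num = a₁.num + 1 := rfl
    obtain ⟨s, hs⟩ := a₁.odd_num
    rw [e]
    by_cases hj : p₁ j < (a₁.num + 1) / 2
    · rw [if_pos hj, if_pos (by omega)]
    · rw [if_neg hj, if_neg (by omega), Nat.add_sub_cancel]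
end

/-- The functor `E_A` from `A` to `D_A`. -/
def EA : ObjA ⥤ DA where
  obj a := ⟨a.num, a.odd_num⟩
  map f := Quotient.lift (fun f => f.frieze) (fun _ _ h => EqA.frieze_eq h) f
  map_id _ := rfl
  map_comp := by rintro _ _ _ ⟨f⟩ ⟨g⟩; rfl

/-- The functor `E_B` from `B` to `D_B`. -/
def EB : ObjB ⥤ DB where
  obj b := ⟨b.num, b.even_num⟩
  map g := Quotient.lift (fun g => g.frieze) (fun _ _ h => EqB.frieze_eq h) g
  map_id _ := rfl
  map_comp := by rintro _ _ _ ⟨f⟩ ⟨g⟩; rfl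

/-- The functor `E` is an isomorphism of categories. -/
def IsCatIso {C D : Type} [Category C] [Category D] (E : C ⥤ D) : Prop :=
  ∃ R : D ⥤ C, E ⋙ R = 𝟭 C ∧ R ⋙ E = 𝟭 D

end FreeAdjunction

namespace FreeAdjunction

/-! ## Normalization -/

-- A frieze of finite type is encoded by a Galois connection `(l, p)` on the natural numbers, hence
-- by the monotone function `p` alone, and gluing friezes becomes composing these functions
-- (`FHom.Rep.comp`). For the type `(2n, 2m)` the function maps {0,…,n-1} monotonically into
-- {0,…,m-1} and is a translation from `n` on. For the type `(2n+1, 2m+1)` it maps {0,…,n}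
-- monotonically to {0,…,m}, sends the top `n` to the top `m`, and is a translation from there on.
-- So the frieze category of `B` is that of finite ordinals and monotone maps, and the one of `A`
-- that of nonempty finite ordinals and monotone maps preserving the top. In this picture `F`
-- adjoins a new top element, `G` forgets that the top is preserved, `φᵃ` repeats the top value once
-- more, and `γᶜ` puts above the old values a new top value that is not attained.
--
-- Three facts carry the theorem. (1) Composition is eliminable: the equations push it inwards past
-- the other symbols until it meets the identity of `∅` (`TermA.exists_normal`,
-- `TermB.exists_normal`). (2) A normal term can be read off its frieze: the cup or cap created by
-- an outermost `φᵃ` or `γᶜ` occupies a point which, under an outermost `F` or `G`, belongs to a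
-- transversal segment, and each of the four operations on friezes is injective, so induction
-- applies (`TermA.IsNormal.eq_of_frieze_eq`, `TermB.IsNormal.eq_of_frieze_eq`). (3) Every
-- admissible function is built by the term operations, by an induction that asks whether the top
-- value is repeated, in `A`, or attained, in `B` (`TermA.exists_rep`, `TermB.exists_rep`).
--
-- Facts (1) and (2), with the invariance of friezes under equality of terms, give injectivity and
-- unique normal forms; (3) gives surjectivity. The functors are thus full and faithful, and they
-- are bijective on objects because a word is determined by its length.

mutual
-- Functoriality, read backwards, expands the identity of a compound word until only the identity of
-- `∅` remains.
theorem TermA.exists_normal_one : (a : ObjA) → ∃ f : TermA a a, f.IsNormal ∧ EqA (.one a) f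
  | .F b =>
    let ⟨g, hg, e⟩ := TermB.exists_normal_one b
    ⟨.F g, by simpa only [TermA.IsNormal] using hg, .trans (.symm (.fun_one b)) (.congr_F e)⟩
theorem TermB.exists_normal_one : (b : ObjB) → ∃ g : TermB b b, g.IsNormal ∧ EqB (.one b) g
  | .gen => ⟨.one .gen, by simp only [TermB.IsNormal], .refl _⟩
  | .G a =>
    let ⟨f, hf, e⟩ := TermA.exists_normal_one a
    ⟨.G f, by simpa only [TermB.IsNormal] using hf, .trans (.symm (.fun_one a)) (.congr_G e)⟩
end

mutual
/-- The number of symbols of a term of `A`. -/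
def TermA.size : {a₁ a₂ : ObjA} → TermA a₁ a₂ → ℕ
  | _, _, .one _ => 1
  | _, _, .comp f₂ f₁ => f₂.size + f₁.size + 1
  | _, _, .F g => g.size + 1
  | _, _, .phi f => f.size + 1
/-- The number of symbols of a term of `B`. -/
def TermB.size : {b₁ b₂ : ObjB} → TermB b₁ b₂ → ℕ
  | _, _, .one _ => 1
  | _, _, .comp g₂ g₁ => g₂.size + g₁.size + 1
  | _, _, .G f => f.size + 1
  | _, _, .gamma g => g.size + 1
end

mutual
/-- Composition of terms in normal form can be eliminated. -/
theorem TermA.exists_normal_comp {a₁ a₂ a₃ : ObjA} (f₂ : TermA a₂ a₃) (f₁ : TermA a₁ a₂)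
    (h₂ : f₂.IsNormal) (h₁ : f₁.IsNormal) :
    ∃ f : TermA a₁ a₃, f.IsNormal ∧ EqA (f₂.comp f₁) f := by
  obtain ⟨N, hN⟩ : ∃ N, N = f₂.size + f₁.size := ⟨_, rfl⟩
  cases f₁ with
  | one a => exact (h₁ : False).elim
  | comp _ _ => exact (h₁ : False).elim
  -- An inner `φᵃ` moves out of the composite whatever the left factor is. No identity of `A` is
  -- normal, so `F` is the only other possible head of the right factor.
  | phi f₁ =>
    obtain ⟨f, hf, e⟩ := TermA.exists_normal_comp f₂ f₁ h₂ h₁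
    exact ⟨.phi f, hf, .trans (.nat₁ _ _) (.congr_phi e)⟩
  | F g₁ =>
    cases f₂ with
    | one a => exact (h₂ : False).elim
    | comp _ _ => exact (h₂ : False).elim
    | F g₂ =>
      obtain ⟨g, hg, e⟩ := TermB.exists_normal_comp g₂ g₁ h₂ h₁
      exact ⟨.F g, hg, .trans (.fun_comp _ _) (.congr_F e)⟩
    | phi f₂ =>
      cases g₁ with
      -- The target of `g₁` is a word beginning with `G`, so this identity is not that of `∅`.
      | one b => exact absurd h₁ (by simp [TermA.IsNormal, TermB.IsNormal])
      | comp _ _ => exact (h₁ : False).elim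
      | G f₁ =>
        obtain ⟨f, hf, e⟩ := TermA.exists_normal_comp f₂ f₁ h₂ h₁
        exact ⟨.phi f, hf, .trans (.nat₂ _ _) (.congr_phi e)⟩
      | gamma g₁ =>
        -- Here `φᵃ` meets `γᶜ` and the two cancel. What is left is again a composite of normal
        -- terms, with two symbols fewer.
        obtain ⟨f, hf, e⟩ := TermA.exists_normal_comp f₂ (.F g₁) h₂ h₁
        exact ⟨f, hf, .trans (.phi_gamma _ _) e⟩
termination_by f₂.size + f₁.size
decreasing_by all_goals simp only [TermA.size, TermB.size] at *; omega
theorem TermB.exists_normal_comp {b₁ b₂ b₃ : ObjB} (g₂ : TermB b₂ b₃) (g₁ : TermB b₁ b₂)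
    (h₂ : g₂.IsNormal) (h₁ : g₁.IsNormal) :
    ∃ g : TermB b₁ b₃, g.IsNormal ∧ EqB (g₂.comp g₁) g := by
  obtain ⟨N, hN⟩ : ∃ N, N = g₂.size + g₁.size := ⟨_, rfl⟩
  cases g₂ with
  -- The only place where a composition disappears outright: a normal left factor that is an
  -- identity is that of `∅`.
  | one b => exact ⟨g₁, h₁, .one_comp _⟩
  | comp _ _ => exact (h₂ : False).elim
  | gamma g₂ =>
    obtain ⟨g, hg, e⟩ := TermB.exists_normal_comp g₂ g₁ h₂ h₁
    exact ⟨.gamma g, hg, .trans (.nat₁ _ _) (.congr_gamma e)⟩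
  | G f₂ =>
    cases g₁ with
    | one b => exact absurd h₁ (by simp [TermB.IsNormal])
    | comp _ _ => exact (h₁ : False).elim
    | G f₁ =>
      obtain ⟨f, hf, e⟩ := TermA.exists_normal_comp f₂ f₁ h₂ h₁
      exact ⟨.G f, hf, .trans (.fun_comp _ _) (.congr_G e)⟩
    | gamma g₁ =>
      cases f₂ with
      | one a => exact (h₂ : False).elim
      | comp _ _ => exact (h₂ : False).elim
      | F g₂ =>
        obtain ⟨g, hg, e⟩ := TermB.exists_normal_comp g₂ g₁ h₂ h₁
        exact ⟨.gamma g, hg, .trans (.nat₂ _ _) (.congr_gamma e)⟩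
      | phi f₂ =>
        -- The dual cancellation: `φᵃ` under `G` annihilates `γᶜ`, again at a cost of two symbols.
        obtain ⟨g, hg, e⟩ := TermB.exists_normal_comp (.G f₂) g₁ h₂ h₁
        exact ⟨g, hg, .trans (.phi_gamma _ _) e⟩
termination_by g₂.size + g₁.size
decreasing_by all_goals simp only [TermA.size, TermB.size] at *; omega
end

mutual
-- Induction on the term: the identity and composition symbols are the only ones that break
-- normality, and each has been dealt with.
theorem TermA.exists_normal : {a₁ a₂ : ObjA} → (f : TermA a₁ a₂) →
    ∃ f' : TermA a₁ a₂, f'.IsNormal ∧ EqA f f'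
  | _, _, .one a => TermA.exists_normal_one a
  | _, _, .comp f₂ f₁ =>
    let ⟨f₂', h₂, e₂⟩ := f₂.exists_normal
    let ⟨f₁', h₁, e₁⟩ := f₁.exists_normal
    let ⟨f, h, e⟩ := TermA.exists_normal_comp f₂' f₁' h₂ h₁
    ⟨f, h, .trans (.congr_comp e₂ e₁) e⟩
  | _, _, .F g =>
    let ⟨g', h, e⟩ := g.exists_normal
    ⟨.F g', h, .congr_F e⟩
  | _, _, .phi f =>
    let ⟨f', h, e⟩ := f.exists_normal
    ⟨.phi f', h, .congr_phi e⟩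
theorem TermB.exists_normal : {b₁ b₂ : ObjB} → (g : TermB b₁ b₂) →
    ∃ g' : TermB b₁ b₂, g'.IsNormal ∧ EqB g g'
  | _, _, .one b => TermB.exists_normal_one b
  | _, _, .comp g₂ g₁ =>
    let ⟨g₂', h₂, e₂⟩ := g₂.exists_normal
    let ⟨g₁', h₁, e₁⟩ := g₁.exists_normal
    let ⟨g, h, e⟩ := TermB.exists_normal_comp g₂' g₁' h₂ h₁
    ⟨g, h, .trans (.congr_comp e₂ e₁) e⟩
  | _, _, .G f =>
    let ⟨f', h, e⟩ := f.exists_normal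
    ⟨.G f', h, .congr_G e⟩
  | _, _, .gamma g =>
    let ⟨g', h, e⟩ := g.exists_normal
    ⟨.gamma g', h, .congr_gamma e⟩
end

/-! ## Terms in normal form are determined by their friezes -/

-- Injectivity of the operations on friezes

lemma FHom.shift_injective {n m : ℕ} : Function.Injective (FHom.shift (n := n) (m := m)) :=
  fun D D' h =>
    have h' : D.shift.segs = D'.shift.segs := congrArg FHom.segs h
    FHom.ext h'

/-- The transversals that the insertion removes are forced by the type, so they lose no information.
Every other segment of `D` survives and cannot be one of the inserted segments: each of those shares
an end point with a removed transversal of `D`, and a point of a frieze lies on only one segment.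
Applied in both directions, this recovers the frieze. -/
lemma insertCup_subset {n m : ℕ} {D D' : Set (ℤ × ℤ)} (hD : IsFrieze D) (ht : HasType D n m)
    (ht' : HasType D' n m) (h : insertCup n m D ⊆ insertCup n m D') : D ⊆ D' := by
  intro s hs
  by_cases hk : ∃ k : ℕ, 0 < k ∧ s = (-((m : ℤ) + k), (n : ℤ) + k)
  · obtain ⟨k, hk, rfl⟩ := hk
    exact ht' k hk
  · rcases h (.inl (.inl ⟨hs, hk⟩)) with (h | rfl) | ⟨k, hk', rfl⟩
    · exact h.1
    -- The inserted cup would meet the first removed transversal at `n + 1`.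
    · exact absurd (hD.share hs (ht 1 one_pos) (a := (n : ℤ) + 1) (.inl rfl) (.inr (by simp)))
        (by simp only [Prod.mk.injEq]; omega)
    -- A shifted transversal keeps its lower end point, which the old one already occupies in `D`.
    · exact absurd (hD.share hs (ht k hk') (a := -((m : ℤ) + k)) (.inl rfl) (.inl rfl))
        (by simp only [Prod.mk.injEq]; omega)

lemma insertCap_subset {n m : ℕ} {D D' : Set (ℤ × ℤ)} (hD : IsFrieze D) (ht : HasType D n m)
    (ht' : HasType D' n m) (h : insertCap n m D ⊆ insertCap n m D') : D ⊆ D' := by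
  intro s hs
  by_cases hk : ∃ k : ℕ, 0 < k ∧ s = (-((m : ℤ) + k), (n : ℤ) + k)
  · obtain ⟨k, hk, rfl⟩ := hk
    exact ht' k hk
  · rcases h (.inl (.inl ⟨hs, hk⟩)) with (h | rfl) | ⟨k, hk', rfl⟩
    · exact h.1
    · exact absurd (hD.share hs (ht 1 one_pos) (a := -((m : ℤ) + 1)) (.inr rfl) (.inl (by simp)))
        (by simp only [Prod.mk.injEq]; omega)
    -- For caps it is the upper end point that stays in place.
    · exact absurd (hD.share hs (ht k hk') (a := (n : ℤ) + k) (.inr rfl) (.inr rfl))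
        (by simp only [Prod.mk.injEq]; omega)

lemma FHom.addCup_injective {n m : ℕ} (hn : Odd n) :
    Function.Injective (FHom.addCup (m := m) hn) := fun D D' h =>
  have h' : insertCup n m D.segs = insertCup n m D'.segs := congrArg FHom.segs h
  FHom.ext ((insertCup_subset D.isFrieze D.hasType D'.hasType h'.subset).antisymm
    (insertCup_subset D'.isFrieze D'.hasType D.hasType h'.superset))

lemma FHom.addCap_injective {n m : ℕ} (hm : Even m) :
    Function.Injective (FHom.addCap (n := n) hm) := fun D D' h =>
  have h' : insertCap n m D.segs = insertCap n m D'.segs := congrArg FHom.segs h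
  FHom.ext ((insertCap_subset D.isFrieze D.hasType D'.hasType h'.subset).antisymm
    (insertCap_subset D'.isFrieze D'.hasType D.hasType h'.superset))

-- The outermost symbol of a normal term is visible on its frieze

/-- The point `n + 2` decides: in a frieze of type `(n + 1, m)` it ends the first transversal,
whereas after the insertion it ends the new cup. This separates the heads `F` and `φᵃ`. -/
lemma FHom.shift_ne_addCup {n m : ℕ} (hn : Odd n) (D : FHom (n + 1) m) (D' : FHom n (m + 1)) :
    D.shift ≠ D'.addCup hn := fun h => by
  have h' : D.segs = insertCup n (m + 1) D'.segs := congrArg FHom.segs h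
  have hc : ((n : ℤ) + 1, (n : ℤ) + 2) ∈ D.segs := h' ▸ .inl (.inr rfl)
  exact absurd (D.isFrieze.share hc (D.hasType 1 one_pos) (a := (n : ℤ) + 2) (.inr rfl)
    (.inr (by push_cast; ring))) (by simp only [Prod.mk.injEq]; omega)

/-- The same conflict on the bottom line, at the point `-(m + 2)`; it separates the heads `G` and
`γᶜ`. -/
lemma FHom.shift_ne_addCap {n m : ℕ} (hm : Even m) (D : FHom n (m + 1)) (D' : FHom (n + 1) m) :
    D.shift ≠ D'.addCap hm := fun h => by
  have h' : D.segs = insertCap (n + 1) m D'.segs := congrArg FHom.segs h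
  have hc : (-((m : ℤ) + 2), -((m : ℤ) + 1)) ∈ D.segs := h' ▸ .inl (.inr rfl)
  exact absurd (D.isFrieze.share hc (D.hasType 1 one_pos) (a := -((m : ℤ) + 2)) (.inl rfl)
    (.inl (by push_cast; ring))) (by simp only [Prod.mk.injEq]; omega)

mutual
-- Equal friezes force equal heads, and injectivity of the corresponding operation passes the
-- equality on to the immediate subterms.
theorem TermA.IsNormal.eq_of_frieze_eq {a₁ a₂ : ObjA} {f₁ f₂ : TermA a₁ a₂} (h₁ : f₁.IsNormal)
    (h₂ : f₂.IsNormal) (h : f₁.frieze = f₂.frieze) : f₁ = f₂ := by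
  obtain ⟨N, hN⟩ : ∃ N, N = f₁.size := ⟨_, rfl⟩
  cases f₁ with
  | one a => exact (h₁ : False).elim
  | comp _ _ => exact (h₁ : False).elim
  | F g₁ =>
    cases f₂ with
    | one a => exact (h₂ : False).elim
    | comp _ _ => exact (h₂ : False).elim
    | F g₂ =>
      exact congrArg TermA.F (TermB.IsNormal.eq_of_frieze_eq (f₁ := g₁) h₁ h₂
        (FHom.shift_injective h))
    | phi f₂ => exact (FHom.shift_ne_addCup _ _ _ h).elim
  | phi f₁ =>
    cases f₂ with
    | one a => exact (h₂ : False).elim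
    | comp _ _ => exact (h₂ : False).elim
    | F g₂ => exact (FHom.shift_ne_addCup _ _ _ h.symm).elim
    | phi f₂ =>
      exact congrArg TermA.phi (TermA.IsNormal.eq_of_frieze_eq (f₁ := f₁) h₁ h₂
        (FHom.addCup_injective _ h))
termination_by f₁.size
decreasing_by all_goals simp only [TermA.size] at *; omega
theorem TermB.IsNormal.eq_of_frieze_eq {b₁ b₂ : ObjB} {f₁ f₂ : TermB b₁ b₂} (h₁ : f₁.IsNormal)
    (h₂ : f₂.IsNormal) (h : f₁.frieze = f₂.frieze) : f₁ = f₂ := by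
  obtain ⟨N, hN⟩ : ∃ N, N = f₁.size := ⟨_, rfl⟩
  cases f₁ with
  | one b =>
    obtain rfl := (h₁ : _ = ObjB.gen)
    -- Only terms from `∅` to `∅` are left; neither `G` nor `γᶜ` ends at `∅`.
    cases f₂ with
    | one b => rfl
    | comp _ _ => exact (h₂ : False).elim
  | comp _ _ => exact (h₁ : False).elim
  | G f₁ =>
    cases f₂ with
    | one b => exact absurd h₂ (by simp [TermB.IsNormal])
    | comp _ _ => exact (h₂ : False).elim
    | G f₂ =>
      exact congrArg TermB.G (TermA.IsNormal.eq_of_frieze_eq (f₁ := f₁) h₁ h₂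
        (FHom.shift_injective h))
    | gamma g₂ => exact (FHom.shift_ne_addCap _ _ _ h).elim
  | gamma g₁ =>
    cases f₂ with
    | one b => exact absurd h₂ (by simp [TermB.IsNormal])
    | comp _ _ => exact (h₂ : False).elim
    | G f₂ => exact (FHom.shift_ne_addCap _ _ _ h.symm).elim
    | gamma g₂ =>
      exact congrArg TermB.gamma (TermB.IsNormal.eq_of_frieze_eq (f₁ := g₁) h₁ h₂
        (FHom.addCap_injective _ h))
termination_by f₁.size
decreasing_by all_goals simp only [TermB.size] at *; omega
end

/-- Both terms have normal forms, which keep their friezes and are therefore the same term. -/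
theorem EqA.of_frieze_eq {a₁ a₂ : ObjA} {f₁ f₂ : TermA a₁ a₂} (h : f₁.frieze = f₂.frieze) :
    EqA f₁ f₂ := by
  obtain ⟨g₁, h₁, e₁⟩ := f₁.exists_normal
  obtain ⟨g₂, h₂, e₂⟩ := f₂.exists_normal
  obtain rfl := h₁.eq_of_frieze_eq h₂ (e₁.frieze_eq.symm.trans (h.trans e₂.frieze_eq))
  exact .trans e₁ (.symm e₂)

theorem EqB.of_frieze_eq {b₁ b₂ : ObjB} {g₁ g₂ : TermB b₁ b₂} (h : g₁.frieze = g₂.frieze) :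
    EqB g₁ g₂ := by
  obtain ⟨f₁, h₁, e₁⟩ := g₁.exists_normal
  obtain ⟨f₂, h₂, e₂⟩ := g₂.exists_normal
  obtain rfl := h₁.eq_of_frieze_eq h₂ (e₁.frieze_eq.symm.trans (h.trans e₂.frieze_eq))
  exact .trans e₁ (.symm e₂)

/-! ## Every frieze is the frieze of a term -/

lemma FHom.Rep.congr {n m : ℕ} {D : FHom n m} {p p' : ℕ → ℕ} (h : D.Rep p)
    (e : ∀ j, p j = p' j) : D.Rep p' :=
  (funext e : p = p') ▸ h

mutual
/-- A monotone function that preserves the top element of the finite ordinals attached to `a₁` and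
`a₂` describes the frieze of a term. -/
theorem TermA.exists_rep (a₁ a₂ : ObjA) {p : ℕ → ℕ} (hp : Monotone p)
    (ht : ∀ i, p (a₁.num / 2 + i) = a₂.num / 2 + i) : ∃ f : TermA a₁ a₂, f.frieze.Rep p := by
  obtain ⟨N, hN⟩ : ∃ N, N = a₁.num + a₂.num := ⟨_, rfl⟩
  obtain ⟨b₁⟩ := a₁
  obtain ⟨b₂⟩ := a₂
  obtain ⟨t, et⟩ := b₂.even_num
  have e₂ : (ObjA.F b₂).num / 2 = b₂.num / 2 := by simp only [ObjA.num]; omega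
  cases b₁ with
  | gen =>
    obtain ⟨g, hg⟩ := TermB.exists_rep .gen b₂ hp (fun i => (ht i).trans (by rw [e₂]))
      -- The ordinal of `∅` is empty, so there is no value to bound.
      (fun j hj => absurd hj (by simp [ObjB.num]))
    exact ⟨.F g, hg⟩
  | G a =>
    obtain ⟨q, eq⟩ := a.odd_num
    have e₁ : (ObjA.F (.G a)).num / 2 = q + 1 := by simp only [ObjA.num, ObjB.num]; omega
    have e₃ : (ObjB.G a).num / 2 = q + 1 := by simp only [ObjB.num]; omega
    have ea : a.num / 2 = q := by omega
    rw [e₁, e₂] at ht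
    -- The top of the source is `q + 1`. If its value already occurs at `q`, the frieze comes from a
    -- `φᵃ`; otherwise only the top attains the top value, and removing both leaves a map of
    -- ordinals in `B`.
    by_cases h : p q = p (q + 1)
    · obtain ⟨f, hf⟩ := TermA.exists_rep a (.F b₂) (p := fun j => if j ≤ q then p j else p (j + 1))
        (fun i j hij => by
          have h1 := hp hij
          have h2 := hp (Nat.succ_le_succ hij)
          have h3 := hp (show i ≤ j + 1 by omega)
          simp only [Nat.succ_eq_add_one] at h2 ⊢
          split_ifs <;> omega)
        (fun i => by
          rw [ea, e₂]
          have h1 := ht i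
          rcases Nat.eq_zero_or_pos i with rfl | hi
          · simpa [h] using h1
          · rw [if_neg (by omega), show q + i + 1 = q + 1 + i by omega, h1])
      refine ⟨.phi f, FHom.Rep.congr hf.addCup fun j => ?_⟩
      rw [ea]
      split_ifs with h1 h2
      · rfl
      · rw [show j = q + 1 by omega, Nat.add_sub_cancel, h]
      · rw [Nat.sub_add_cancel (by omega)]
    · obtain ⟨g, hg⟩ := TermB.exists_rep (.G a) b₂ hp (fun i => by rw [e₃, ht i])
        (fun j hj => by
          have h1 := hp (show j ≤ q by omega)
          have h2 := hp (Nat.le_succ q)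
          have h3 := ht 0
          simp only [Nat.succ_eq_add_one, add_zero] at h2 h3
          omega)
      exact ⟨.F g, hg⟩
termination_by a₁.num + a₂.num
decreasing_by all_goals simp only [ObjA.num, ObjB.num] at *; omega
/-- A monotone function between the finite ordinals attached to `b₁` and `b₂` describes the frieze
of a term. -/
theorem TermB.exists_rep (b₁ b₂ : ObjB) {p : ℕ → ℕ} (hp : Monotone p)
    (ht : ∀ i, p (b₁.num / 2 + i) = b₂.num / 2 + i)
    (hlt : ∀ j < b₁.num / 2, p j < b₂.num / 2) : ∃ g : TermB b₁ b₂, g.frieze.Rep p := by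
  obtain ⟨N, hN⟩ : ∃ N, N = b₁.num + b₂.num := ⟨_, rfl⟩
  cases b₂ with
  | gen =>
    cases b₁ with
    | gen =>
      exact ⟨.one .gen, FHom.Rep.congr (.unit _) fun j => by simpa [ObjB.num] using (ht j).symm⟩
    | G a =>
      obtain ⟨q, eq⟩ := a.odd_num
      -- A nonempty ordinal has no map to the empty one.
      exact absurd (hlt 0 (by simp only [ObjB.num]; omega)) (by simp [ObjB.num])
  | G a =>
    obtain ⟨b⟩ := a
    have e₂ : (ObjB.G (.F b)).num / 2 = b.num / 2 + 1 := by simp only [ObjA.num, ObjB.num]; omega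
    have eb : (ObjA.F b).num / 2 = b.num / 2 := by
      obtain ⟨t, et⟩ := b.even_num
      simp only [ObjA.num]; omega
    rw [e₂] at ht hlt
    -- The top value of the target is `b.num / 2`. If it is not attained on the source ordinal, the
    -- frieze comes from a `γᶜ`; otherwise `p` preserves the top and the term begins with `G`.
    by_cases h : ∀ j < b₁.num / 2, p j < b.num / 2
    · obtain ⟨g, hg⟩ := TermB.exists_rep b₁ b
        -- The value `b.num / 2` is skipped by the translation part too, which starts one higher, so
        -- closing the gap loses nothing.
        (p := fun j => if p j < b.num / 2 then p j else p j - 1)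
        (fun i j hij => by
          have h1 := hp hij
          have h2 := h i
          have h3 := ht 0
          have h4 := h j
          by_cases hj : j < b₁.num / 2
          · simp only; split_ifs <;> omega
          · have h5 := ht (j - b₁.num / 2)
            rw [Nat.add_sub_cancel' (by omega)] at h5
            simp only; split_ifs <;> omega)
        (fun i => by
          have h1 := ht i
          split_ifs <;> omega)
        (fun j hj => by
          have h1 := h j hj
          split_ifs; omega)
      refine ⟨.gamma g, FHom.Rep.congr hg.addCap fun j => ?_⟩
      have h1 := h j
      by_cases hj : j < b₁.num / 2
      · split_ifs <;> omega
      · have h5 := ht (j - b₁.num / 2)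
        rw [Nat.add_sub_cancel' (by omega)] at h5
        split_ifs <;> omega
    · push Not at h
      obtain ⟨j, hj, hpj⟩ := h
      cases b₁ with
      | gen => simp [ObjB.num] at hj
      | G a =>
        obtain ⟨b'⟩ := a
        obtain ⟨s, es⟩ := b'.even_num
        have e₁ : (ObjB.G (.F b')).num / 2 = (ObjA.F b').num / 2 + 1 := by
          simp only [ObjA.num, ObjB.num]; omega
        rw [e₁] at ht hlt hj
        -- The function is unchanged, but its translation part now starts one step earlier, at the
        -- top element. There monotonicity bounds the value from below by the value at `j`, and
        -- `hlt` bounds it from above.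
        obtain ⟨f, hf⟩ := TermA.exists_rep (.F b') (.F b) hp (fun i => by
          rw [eb]
          rcases Nat.eq_zero_or_pos i with rfl | hi
          · have h1 := hp (show j ≤ (ObjA.F b').num / 2 by omega)
            have h2 := hlt ((ObjA.F b').num / 2) (by omega)
            rw [add_zero]
            omega
          · have h1 := ht (i - 1)
            rw [show (ObjA.F b').num / 2 + 1 + (i - 1) = (ObjA.F b').num / 2 + i by omega] at h1
            omega)
        exact ⟨.G f, hf⟩
termination_by b₁.num + b₂.num
decreasing_by all_goals simp only [ObjA.num, ObjB.num] at *; omega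
end

theorem TermA.exists_frieze_eq {a₁ a₂ : ObjA} (D : FHom a₁.num a₂.num) :
    ∃ f : TermA a₁ a₂, f.frieze = D := by
  obtain ⟨p, hp⟩ := D.exists_fn
  obtain ⟨q, hq⟩ := a₁.odd_num
  obtain ⟨r, hr⟩ := a₂.odd_num
  obtain ⟨f, hf⟩ := TermA.exists_rep a₁ a₂ hp.mono fun i => by
    -- Labels halve the points, so odd steps along the transversals already give every index of the
    -- translation part.
    have := hp.tail (2 * i + 1) (by omega)
    rwa [show (a₁.num + (2 * i + 1) - 1) / 2 = a₁.num / 2 + i by omega,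
      show (a₂.num + (2 * i + 1) - 1) / 2 = a₂.num / 2 + i by omega] at this
  exact ⟨f, hf.eq hp fun _ => rfl⟩

theorem TermB.exists_frieze_eq {b₁ b₂ : ObjB} (D : FHom b₁.num b₂.num) :
    ∃ g : TermB b₁ b₂, g.frieze = D := by
  obtain ⟨p, hp⟩ := D.exists_fn
  obtain ⟨q, hq⟩ := b₁.even_num
  obtain ⟨r, hr⟩ := b₂.even_num
  obtain ⟨g, hg⟩ := TermB.exists_rep b₁ b₂ hp.mono (fun i => by
    have := hp.tail (2 * i + 1) (by omega)
    rwa [show (b₁.num + (2 * i + 1) - 1) / 2 = b₁.num / 2 + i by omega,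
      show (b₂.num + (2 * i + 1) - 1) / 2 = b₂.num / 2 + i by omega] at this)
    (fun j hj => by
      -- In `B` the source ordinal need not have a top that is preserved, so the bound on its values
      -- is a separate requirement.
      have := hp.lt (j := j) (by omega)
      omega)
  exact ⟨g, hg.eq hp fun _ => rfl⟩

/-! ## Isomorphisms of categories -/

/-- The inverse functor takes the inverse on objects and, on an arrow, the preimage of that arrow
conjugated by the canonical isomorphisms `E (r X) = X`. Faithfulness reduces its functor laws, and
the fact that it is a left inverse, to identities between images under `E`. -/
theorem IsCatIso.of_bijective_obj {C D : Type} [Category C] [Category D] (E : C ⥤ D) [E.Full]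
    [E.Faithful] (h : Function.Bijective E.obj) : IsCatIso E := by
  obtain ⟨r, hr, hr'⟩ := Function.bijective_iff_has_inverse.1 h
  let R : D ⥤ C :=
    { obj := r
      map := fun {X Y} u => E.preimage (eqToHom (hr' X) ≫ u ≫ eqToHom (hr' Y).symm)
      map_id := fun X => E.map_injective (by simp)
      map_comp := fun u v => E.map_injective (by simp) }
  refine ⟨R, CategoryTheory.Functor.ext hr fun X Y u => E.map_injective ?_,
    CategoryTheory.Functor.ext hr' fun X Y u => ?_⟩
  · simp [R, eqToHom_map]
  · simp [R]

mutual
-- The letters `F` and `G` alternate, so the length of a word determines it.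
theorem ObjA.eq_of_num_eq : (a a' : ObjA) → a.num = a'.num → a = a'
  | .F b, .F b', h => congrArg ObjA.F (ObjB.eq_of_num_eq b b' (Nat.succ_injective h))
theorem ObjB.eq_of_num_eq : (b b' : ObjB) → b.num = b'.num → b = b'
  | .gen, .gen, _ => rfl
  | .G a, .G a', h => congrArg ObjB.G (ObjA.eq_of_num_eq a a' (Nat.succ_injective h))
end

theorem ObjB.exists_num_eq : (k : ℕ) → ∃ b : ObjB, b.num = k + k
  | 0 => ⟨.gen, rfl⟩
  | k + 1 =>
    let ⟨b, hb⟩ := ObjB.exists_num_eq k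
    ⟨.G (.F b), by simp only [ObjB.num, ObjA.num]; omega⟩

theorem EA_obj_bijective : Function.Bijective EA.obj := by
  refine ⟨fun a a' h => ObjA.eq_of_num_eq a a' (congrArg DA.val h), ?_⟩
  rintro ⟨n, k, hk⟩
  obtain ⟨b, hb⟩ := ObjB.exists_num_eq k
  obtain rfl : n = (ObjA.F b).num := by simp only [ObjA.num]; omega
  exact ⟨.F b, rfl⟩

theorem EB_obj_bijective : Function.Bijective EB.obj := by
  refine ⟨fun b b' h => ObjB.eq_of_num_eq b b' (congrArg DB.val h), ?_⟩
  rintro ⟨n, k, hk⟩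
  obtain ⟨b, hb⟩ := ObjB.exists_num_eq k
  obtain rfl : n = b.num := hk.trans hb.symm
  exact ⟨b, rfl⟩

-- Fullness and faithfulness of the two functors

instance : EA.Full where
  map_surjective D :=
    let ⟨f, hf⟩ := TermA.exists_frieze_eq D
    ⟨⟦f⟧, hf⟩

instance : EA.Faithful where
  map_injective {_ _ f₁ f₂} := by
    induction f₁ using Quotient.inductionOn
    induction f₂ using Quotient.inductionOn
    exact fun h => Quotient.sound (EqA.of_frieze_eq h)

instance : EB.Full where
  map_surjective D :=
    let ⟨g, hg⟩ := TermB.exists_frieze_eq D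
    ⟨⟦g⟧, hg⟩

instance : EB.Faithful where
  map_injective {_ _ g₁ g₂} := by
    induction g₁ using Quotient.inductionOn
    induction g₂ using Quotient.inductionOn
    exact fun h => Quotient.sound (EqB.of_frieze_eq h)

end FreeAdjunction

theorem mainTheorem4 :
    -- `E_A` and `E_B` are isomorphisms of categories
    (FreeAdjunction.IsCatIso FreeAdjunction.EA ∧ FreeAdjunction.IsCatIso FreeAdjunction.EB) ∧
    -- surjectivity on arrows
    ((∀ (a₁ a₂ : FreeAdjunction.ObjA) (D : FreeAdjunction.FHom a₁.num a₂.num),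
        ∃ f : FreeAdjunction.TermA a₁ a₂, f.frieze = D) ∧
      (∀ (b₁ b₂ : FreeAdjunction.ObjB) (D : FreeAdjunction.FHom b₁.num b₂.num),
        ∃ g : FreeAdjunction.TermB b₁ b₂, g.frieze = D)) ∧
    -- terms in normal form with the same frieze are the same term
    ((∀ (a₁ a₂ : FreeAdjunction.ObjA) (f₁ f₂ : FreeAdjunction.TermA a₁ a₂),
        f₁.IsNormal → f₂.IsNormal → f₁.frieze = f₂.frieze → f₁ = f₂) ∧
      (∀ (b₁ b₂ : FreeAdjunction.ObjB) (g₁ g₂ : FreeAdjunction.TermB b₁ b₂),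
        g₁.IsNormal → g₂.IsNormal → g₁.frieze = g₂.frieze → g₁ = g₂)) ∧
    -- terms with the same frieze are equal in `A`, respectively `B`
    ((∀ (a₁ a₂ : FreeAdjunction.ObjA) (f₁ f₂ : FreeAdjunction.TermA a₁ a₂),
        f₁.frieze = f₂.frieze → FreeAdjunction.EqA f₁ f₂) ∧
      (∀ (b₁ b₂ : FreeAdjunction.ObjB) (g₁ g₂ : FreeAdjunction.TermB b₁ b₂),
        g₁.frieze = g₂.frieze → FreeAdjunction.EqB g₁ g₂)) ∧
    -- every term is equal to exactly one term in normal form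
    ((∀ (a₁ a₂ : FreeAdjunction.ObjA) (f : FreeAdjunction.TermA a₁ a₂),
        ∃! f' : FreeAdjunction.TermA a₁ a₂, f'.IsNormal ∧ FreeAdjunction.EqA f f') ∧
      (∀ (b₁ b₂ : FreeAdjunction.ObjB) (g : FreeAdjunction.TermB b₁ b₂),
        ∃! g' : FreeAdjunction.TermB b₁ b₂, g'.IsNormal ∧ FreeAdjunction.EqB g g')) :=
  ⟨⟨FreeAdjunction.IsCatIso.of_bijective_obj _ FreeAdjunction.EA_obj_bijective,
      FreeAdjunction.IsCatIso.of_bijective_obj _ FreeAdjunction.EB_obj_bijective⟩,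
    ⟨fun _ _ => FreeAdjunction.TermA.exists_frieze_eq,
      fun _ _ => FreeAdjunction.TermB.exists_frieze_eq⟩,
    ⟨fun _ _ _ _ h₁ h₂ => h₁.eq_of_frieze_eq h₂, fun _ _ _ _ h₁ h₂ => h₁.eq_of_frieze_eq h₂⟩,
    ⟨fun _ _ _ _ => FreeAdjunction.EqA.of_frieze_eq,
      fun _ _ _ _ => FreeAdjunction.EqB.of_frieze_eq⟩,
    ⟨fun _ _ f =>
      let ⟨f', h, e⟩ := f.exists_normal
      -- Uniqueness needs no confluence argument: any normal form of `f` has the frieze of `f`, and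
      -- that determines it.
      ⟨f', ⟨h, e⟩, fun _ h' => h'.1.eq_of_frieze_eq h (h'.2.frieze_eq.symm.trans e.frieze_eq)⟩,
    fun _ _ g =>
      let ⟨g', h, e⟩ := g.exists_normal
      ⟨g', ⟨h, e⟩, fun _ h' => h'.1.eq_of_frieze_eq h (h'.2.frieze_eq.symm.trans e.frieze_eq)⟩⟩⟩
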